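/- Let $b,c$ be positive integers with $b$ odd such that $d=b^2+c^2$ is square-free, and let $a$ be an odd square-free integer with $\gcd(a,d)=1$. Let $L$ be the cyclic quartic field $\mathbb{Q}\big(\sqrt{a(d+b\sqrt d)}\big)$ or, when $c$ is even, possibly the cyclic quartic field $\mathbb{Q}\big(\sqrt{a(d+c\sqrt d)}\big)$. Suppose that either $d$ is odd and the Jacobi symbol $\left(\frac{b}{d}\right)$ equals $-1$, or $d$ is even and the Jacobi symbol $\left(\frac{b}{d/2}\right)$ equals $-1$. Then: 1. the equation $x^2-dy^2=b$ has no solution in integers $x,y$; 2. if $H$ is the non-classical Hopf–Galois structure on $L/\mathbb{Q}$, then the ring of integers $\mathcal{O}_L$ is not free as a module over its associated order $\mathfrak{A}_H=\{h\in H : h\cdot\mathcal{O}_L\subseteq\mathcal{O}_L\}$. Here a Hopf–Galois structure on $L/\mathbb{Q}$ is a finite-dimensional cocommutative $\mathbb{Q}$-Hopf algebra $H$ with a $\mathbb{Q}$-linear action on $L$ making $L$ a left $H$-module algebra, such that the map $L\otimes_{\mathbb{Q}}H\to\mathrm{End}_{\mathbb{Q}}(L)$, $x\otimes h\mapsto(y\mapsto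 x(h\cdot y))$, is bijective. It is called classical if it is isomorphic, as a Hopf algebra acting on $L$, to the group algebra $\mathbb{Q}[\mathrm{Gal}(L/\mathbb{Q})]$ with its usual action; up to isomorphism there is exactly one non-classical structure on such an $L$. -/

import Mathlib

open scoped TensorProduct NumberField

/-- A Hopf-Galois structure, with underlying Hopf algebra `H`, on the field extension `L/K`:
`H` is finite-dimensional and cocommutative, it acts `K`-linearly on `L` so that `L` is a left
`H`-module algebra, and `L ⊗ H → End_K(L)`, `x ⊗ h ↦ (y ↦ x * (h · y))`, is bijective. -/
structure HopfGaloisStructure (K L H : Type*) [Field K] [Field L] [Algebra K L]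
    [Ring H] [HopfAlgebra K H] where
  finiteDimensional : FiniteDimensional K H
  isCocomm : Coalgebra.IsCocomm K H
  /-- The action `h ↦ (x ↦ h · x)` of `H` on `L`. -/
  act : H →ₐ[K] Module.End K L
  /-- `h · (x y) = ∑ (h₁ · x) (h₂ · y)`. -/
  act_mul : ∀ (h : H) (x y : L), act h (x * y) =
    TensorProduct.lift ((LinearMap.mul K L).compl₁₂
      (act.toLinearMap.flip x) (act.toLinearMap.flip y)) (Coalgebra.comul (R := K) h)
  /-- `h · 1 = ε(h) 1`. -/
  act_one : ∀ h : H, act h 1 = algebraMap K L (Coalgebra.counit (R := K) h)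
  bijective : Function.Bijective (TensorProduct.lift
    ((LinearMap.mul K (Module.End K L)).compl₁₂
      (LinearMap.mul K L) act.toLinearMap) : L ⊗[K] H →ₗ[K] Module.End K L)

namespace HopfGaloisStructure

variable {K L H : Type*} [Field K] [Field L] [Algebra K L] [Ring H] [HopfAlgebra K H]

/-- The structure is (isomorphic to) the classical one: some isomorphism of Hopf algebras from
the group algebra `K[Gal(L/K)]` to `H` carries the usual action on `L` to the action of `H`. -/
def IsClassical (S : HopfGaloisStructure K L H) : Prop :=
  ∃ e : MonoidAlgebra K (L ≃ₐ[K] L) ≃ₐc[K] H,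
    ∀ (g : L ≃ₐ[K] L) (x : L), S.act (e (MonoidAlgebra.single g 1)) x = g x

/-- The associated order of the ring of integers of `L`: the set of `h` in `H` with
`h · 𝓞 L ⊆ 𝓞 L`. -/
def associatedOrder (S : HopfGaloisStructure K L H) : Subring H where
  carrier := {h | ∀ x : 𝓞 L, IsIntegral ℤ (S.act h x)}
  mul_mem' := by
    intro g h hg hh x
    rw [map_mul]
    exact hg ⟨_, hh x⟩
  one_mem' := by
    intro x
    rw [map_one]
    exact x.2
  add_mem' := by
    intro g h hg hh x
    rw [map_add]
    exact (hg x).add (hh x)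
  zero_mem' := by
    intro x
    rw [map_zero]
    exact isIntegral_zero
  neg_mem' := by
    intro h hh x
    rw [map_neg]
    exact (hh x).neg

/-- The ring of integers as a module over its associated order, `h` acting by `x ↦ h · x`. -/
instance (S : HopfGaloisStructure K L H) : Module S.associatedOrder (𝓞 L) where
  smul h x := ⟨S.act h x, h.2 x⟩
  one_smul x := NumberField.RingOfIntegers.ext (by
    change S.act 1 (x : L) = x
    rw [map_one]; rfl)
  mul_smul g h x := NumberField.RingOfIntegers.ext (by
    change S.act ((g : H) * h) (x : L) = S.act g (S.act h x)
    rw [map_mul]; rfl)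
  smul_zero h := NumberField.RingOfIntegers.ext (map_zero (S.act h))
  smul_add h x y := NumberField.RingOfIntegers.ext (map_add (S.act h) (x : L) y)
  add_smul g h x := NumberField.RingOfIntegers.ext (by
    change S.act ((g : H) + h) (x : L) = S.act g x + S.act h x
    rw [map_add]; rfl)
  zero_smul x := NumberField.RingOfIntegers.ext (by
    change S.act 0 (x : L) = 0
    rw [map_zero]; rfl)

end HopfGaloisStructure

/-! ### Galois automorphisms as an `L`-basis of `End_K(L)` -/

section GaloisBasis

variable (K L : Type*) [Field K] [Field L] [Algebra K L]

/-! Since the Galois automorphisms form an `L`-basis of `End_K(L)`, each `h` in `H` acts as `∑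
c_g(h) g`. The coefficient functions `c_g : H → L` form an `L`-basis of `Hom_K(H, L)`, and the
module algebra axiom makes them orthogonal idempotents for convolution, so Galois permutes them. For
a cyclic quartic group `⟨σ⟩` the only possible permutations under `σ` are the identity, which forces
the classical structure, and the exchange of `c_σ` and `c_{σ³}`.

Write `s² = d`, and let `u`, `v = σ u` be the square roots generating `L`. In the non-classical case
`h` acts on `ℚu + ℚv` as `P + Q s σ` with `P`, `Q` rational. The projection of the ring of integers
to `ℚu + ℚv` is a lattice stable under `σ`, that is, under multiplication by `i`. A local analysis
at 2, together with square-freeness of `a d`, shows that it is `μ(ℤu + ℤv)`. In the second family of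
fields this requires first replacing `u`, `v` by `u + v`, `u - v`, which restores the roles of `b`
and `c`.

If the integers are free over the associated order, the rank is one. Elements of the order preserve
the lattice, and `gcd(b, 2c) = 1` then makes `P` and `Q` integers. If `μ(xu + yv)` is the component
of a generator, its images fill the lattice, so an integer matrix with determinant `-(bx² + 2cxy -
by²)` is invertible. The form thus takes a value `±1`. Multiplying by `b` and completing the square,
with either sign, solves `X² - dY² = b`. Reduction modulo `d` or `d/2` makes `b` a square there,
contrary to the Jacobi symbol. -/

theorem linearIndependent_galois_toLinearMap :
    LinearIndependent L (fun g : L ≃ₐ[K] L => (g : L ≃ₐ[K] L).toLinearMap) := by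
  have h := linearIndependent_toLinearMap K L L
  exact h.comp (fun g : L ≃ₐ[K] L => (g : L →ₐ[K] L)) (fun g g' hg => AlgEquiv.coe_toAlgHom_injective hg)

variable [FiniteDimensional K L] [IsGalois K L]

/-- The automorphisms of a finite Galois extension `L/K`, as an `L`-basis of `End_K(L)`. -/
noncomputable def galoisEndBasis : Module.Basis (L ≃ₐ[K] L) L (Module.End K L) :=
  basisOfLinearIndependentOfCardEqFinrank (linearIndependent_galois_toLinearMap K L) (by
    rw [Module.finrank_linearMap_self, ← Nat.card_eq_fintype_card, IsGalois.card_aut_eq_finrank])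

@[simp]
theorem galoisEndBasis_apply (g : L ≃ₐ[K] L) : galoisEndBasis K L g = g.toLinearMap := by
  simp [galoisEndBasis]

variable {K L} in
theorem galois_coeff_ext {f f' : (L ≃ₐ[K] L) → L}
    (h : ∀ x, ∑ g, f g * g x = ∑ g, f' g * g x) : f = f' := by
  have key : ∑ g, f g • galoisEndBasis K L g = ∑ g, f' g • galoisEndBasis K L g := by
    ext x
    simpa using h x
  funext g
  have := congrArg (fun t => (galoisEndBasis K L).repr t g) key
  classical
  simpa [-galoisEndBasis_apply, Finsupp.single_apply] using this

end GaloisBasis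

/-! ### Coefficient functions of a Hopf–Galois structure and their Galois symmetry -/

namespace HopfGaloisStructure

variable {K L H : Type*} [Field K] [Field L] [Algebra K L] [Ring H] [HopfAlgebra K H]

section Convolution

/-- The convolution product of linear maps from the coalgebra `H` to `L`. -/
noncomputable def conv : (H →ₗ[K] L) →ₗ[L] (H →ₗ[K] L) →ₗ[L] (H →ₗ[K] L) :=
  LinearMap.mk₂ L (fun f g => TensorProduct.lift ((LinearMap.mul K L).compl₁₂ f g) ∘ₗ
      Coalgebra.comul (R := K))
    (fun f f' g => by
      rw [← LinearMap.add_comp]; congr 1; ext; simp)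
    (fun r f g => by
      rw [← LinearMap.smul_comp]; congr 1; ext; simp [mul_assoc])
    (fun f g g' => by
      rw [← LinearMap.add_comp]; congr 1; ext; simp [mul_add])
    (fun r f g => by
      rw [← LinearMap.smul_comp]; congr 1; ext; simp [mul_left_comm])

theorem conv_apply (f g : H →ₗ[K] L) (h : H) :
    conv f g h = TensorProduct.lift ((LinearMap.mul K L).compl₁₂ f g)
      (Coalgebra.comul (R := K) h) := rfl

theorem conv_algEquiv_comp (τ : L ≃ₐ[K] L) (f g : H →ₗ[K] L) :
    conv (τ.toLinearMap ∘ₗ f) (τ.toLinearMap ∘ₗ g) = τ.toLinearMap ∘ₗ conv f g := by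
  ext h
  have key : TensorProduct.lift ((LinearMap.mul K L).compl₁₂ (τ.toLinearMap ∘ₗ f)
      (τ.toLinearMap ∘ₗ g)) = τ.toLinearMap ∘ₗ
        TensorProduct.lift ((LinearMap.mul K L).compl₁₂ f g) :=
    TensorProduct.ext' fun a b => by simp
  simp only [conv_apply, LinearMap.comp_apply, key]

end Convolution

theorem act_injective (S : HopfGaloisStructure K L H) : Function.Injective S.act := by
  intro h h' e
  have := S.bijective.1 (a₁ := (1 : L) ⊗ₜ[K] h) (a₂ := (1 : L) ⊗ₜ[K] h') (by
    ext x
    simp [e])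
  have hinj := Algebra.TensorProduct.includeRight_injective (R := K) (A := L) (B := H)
    (FaithfulSMul.algebraMap_injective K L)
  exact hinj this

variable [FiniteDimensional K L] [IsGalois K L] (S : HopfGaloisStructure K L H)

/-- The coefficient of the automorphism `g` in the action of an element of `H`. -/
noncomputable def coeff (g : L ≃ₐ[K] L) : H →ₗ[K] L :=
  ((galoisEndBasis K L).coord g).restrictScalars K ∘ₗ S.act.toLinearMap

theorem act_apply (h : H) (x : L) : S.act h x = ∑ g, S.coeff g h * g x := by
  have := congrArg (fun t => t x) ((galoisEndBasis K L).sum_repr (S.act h))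
  simpa [coeff] using this.symm

theorem coeff_eq_of_act {h : H} {f : (L ≃ₐ[K] L) → L} (hf : ∀ x, S.act h x = ∑ g, f g * g x)
    (g : L ≃ₐ[K] L) : S.coeff g h = f g :=
  congrFun (galois_coeff_ext (f := fun g => S.coeff g h) fun x => by rw [← act_apply, hf]) g

/-- A relation among the coefficient functions is an `L`-linear functional on `End_K(L)` vanishing
on every `x • S.act h`. These elements span by bijectivity in the Hopf–Galois condition, so the
functional is zero. -/
theorem linearIndependent_coeff : LinearIndependent L S.coeff := by
  rw [Fintype.linearIndependent_iff]
  intro m hm g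
  set φ : Module.End K L →ₗ[L] L := ∑ g, m g • (galoisEndBasis K L).coord g with hφ
  have h0 : ∀ t, φ t = 0 := by
    intro t
    obtain ⟨w, rfl⟩ := S.bijective.2 t
    induction w with
    | zero => simp
    | add a b ha hb => rw [map_add, map_add, ha, hb, add_zero]
    | tmul x h =>
      have e : (TensorProduct.lift ((LinearMap.mul K (Module.End K L)).compl₁₂
          (LinearMap.mul K L) S.act.toLinearMap)) (x ⊗ₜ[K] h) = x • S.act h := by
        ext; simp
      rw [e, map_smul]
      have := LinearMap.congr_fun hm h
      simp only [LinearMap.sum_apply, LinearMap.smul_apply, LinearMap.zero_apply] at this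
      have e2 : φ (S.act h) = 0 := by
        rw [← this, hφ]
        simp [coeff]
      rw [e2, smul_zero]
  have := h0 (galoisEndBasis K L g)
  rw [hφ] at this
  classical
  simpa [-galoisEndBasis_apply, LinearMap.sum_apply, Finsupp.single_apply] using this

theorem finrank_eq (S : HopfGaloisStructure K L H) :
    Module.finrank K H = Module.finrank K L := by
  have := S.finiteDimensional
  have e := (LinearEquiv.ofBijective _ S.bijective).finrank_eq
  rw [Module.finrank_tensorProduct, Module.finrank_linearMap] at e
  exact Nat.eq_of_mul_eq_mul_left Module.finrank_pos e

theorem exists_eq_sum_coeff (f : H →ₗ[K] L) :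
    ∃ m : (L ≃ₐ[K] L) → L, f = ∑ g, m g • S.coeff g := by
  have := S.finiteDimensional
  let B := basisOfLinearIndependentOfCardEqFinrank S.linearIndependent_coeff (by
    rw [Module.finrank_linearMap_self, S.finrank_eq, ← Nat.card_eq_fintype_card,
      IsGalois.card_aut_eq_finrank])
  refine ⟨fun g => B.repr f g, ?_⟩
  conv_lhs => rw [← B.sum_repr f]
  simp [B]

/-- Expand `h · (xy)` both by the comultiplication and as `∑ c_g(h) g(x) g(y)`. Independence of
automorphisms, used first in `x` and then in `y`, compares the coefficients. -/
theorem conv_coeff [DecidableEq (L ≃ₐ[K] L)] (a b : L ≃ₐ[K] L) :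
    conv (S.coeff a) (S.coeff b) = if a = b then S.coeff a else 0 := by
  have hflip : ∀ x, S.act.toLinearMap.flip x = ∑ g, g x • S.coeff g := by
    intro x
    ext h
    simp [act_apply, mul_comm]
  ext h
  have h1 : ∀ y, (fun a => ∑ b, conv (S.coeff a) (S.coeff b) h * b y) =
      fun a => S.coeff a h * a y := by
    intro y
    apply galois_coeff_ext
    intro x
    have e := S.act_mul h x y
    rw [act_apply, ← conv_apply, hflip, hflip] at e
    simp only [map_sum, map_smul, LinearMap.sum_apply, LinearMap.smul_apply, map_mul,
      smul_eq_mul] at e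
    calc ∑ g, (∑ b, conv (S.coeff g) (S.coeff b) h * b y) * g x
        = ∑ b, b y * ∑ g, g x * conv (S.coeff g) (S.coeff b) h := by
          simp only [Finset.sum_mul, Finset.mul_sum]
          rw [Finset.sum_comm]
          exact Finset.sum_congr rfl fun _ _ => Finset.sum_congr rfl fun _ _ => by ring
      _ = ∑ g, S.coeff g h * (g x * g y) := e.symm
      _ = _ := Finset.sum_congr rfl fun _ _ => by ring
  have h2 : (fun b => conv (S.coeff a) (S.coeff b) h) =
      fun b => if a = b then S.coeff a h else 0 := by
    apply galois_coeff_ext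
    intro y
    rw [congrFun (h1 y) a]
    simp
  rw [congrFun h2 b]
  split_ifs <;> rfl

/-- An automorphism of `L` permutes the coefficient functions. -/
theorem exists_perm (τ : L ≃ₐ[K] L) : ∃ π : Equiv.Perm (L ≃ₐ[K] L),
    ∀ g h, τ (S.coeff g h) = S.coeff (π g) h := by
  classical
  choose m hm using fun g => S.exists_eq_sum_coeff (τ.toLinearMap ∘ₗ S.coeff g)
  -- `τ` respects convolution, so the transformed functions are again orthogonal idempotents. Their
  -- coordinates are therefore 0 or 1, with disjoint supports for distinct `g`; nonempty supports
  -- and counting then make each support a single point.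
  have horth : ∀ g g' a, m g a * m g' a = if g = g' then m g a else 0 := by
    intro g g' a
    have e := conv_algEquiv_comp τ (S.coeff g) (S.coeff g')
    rw [S.conv_coeff, hm g, hm g'] at e
    simp only [map_sum, map_smul, LinearMap.sum_apply, LinearMap.smul_apply, conv_coeff,
      smul_ite, smul_zero, Finset.sum_ite_eq', Finset.mem_univ, if_true] at e
    have e' : ∑ x, (m g x * m g' x - if g = g' then m g x else 0) • S.coeff x = 0 := by
      ext h
      have e1 := LinearMap.congr_fun e h
      have e2 := LinearMap.congr_fun (hm g) h
      simp only [LinearMap.sum_apply, LinearMap.smul_apply, LinearMap.comp_apply,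
        smul_eq_mul, AlgEquiv.toLinearMap_apply, LinearMap.zero_apply, sub_mul,
        Finset.sum_sub_distrib] at e1 e2 ⊢
      rw [sub_eq_zero]
      refine Eq.trans (Finset.sum_congr rfl fun x _ => by ring) (e1.trans ?_)
      split_ifs with hg
      · exact e2
      · simp
    exact sub_eq_zero.1 (Fintype.linearIndependent_iff.1 S.linearIndependent_coeff _ e' a)
  have hne : ∀ g, ∃ a, m g a ≠ 0 := by
    intro g
    by_contra! hall
    have h0 : τ.toLinearMap ∘ₗ S.coeff g = 0 := by rw [hm g]; simp [hall]
    apply S.linearIndependent_coeff.ne_zero g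
    ext h
    have := LinearMap.congr_fun h0 h
    simpa using this
  choose p hp using hne
  have hp1 : ∀ g, m g (p g) = 1 := fun g => by
    have := horth g g (p g)
    rw [if_pos rfl] at this
    exact mul_left_cancel₀ (hp g) (by rw [this, mul_one])
  have hpinj : Function.Injective p := by
    intro g g' h
    by_contra hg
    have := horth g g' (p g)
    rw [if_neg hg, hp1, one_mul, h, hp1] at this
    exact one_ne_zero this
  refine ⟨Equiv.ofBijective p (Finite.injective_iff_bijective.1 hpinj), fun g h => ?_⟩
  have e := LinearMap.congr_fun (hm g) h
  have hz : ∀ a, a ≠ p g → m g a = 0 := by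
    intro a ha
    obtain ⟨g', rfl⟩ := (Finite.injective_iff_surjective.1 hpinj) a
    have hg : g ≠ g' := fun h => ha (by rw [h])
    have := horth g g' (p g')
    rwa [if_neg hg, hp1, mul_one] at this
  simp only [LinearMap.comp_apply, AlgEquiv.toLinearMap_apply, LinearMap.sum_apply] at e
  rw [e, Finset.sum_eq_single (p g)]
  · simp [hp1]
  · intro a _ ha
    simp [hz a ha]
  · simp

theorem coeff_one [DecidableEq (L ≃ₐ[K] L)] (g : L ≃ₐ[K] L) :
    S.coeff g 1 = if g = 1 then 1 else 0 :=
  S.coeff_eq_of_act (f := fun g => if g = 1 then 1 else 0) (by simp) g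

theorem coeff_mul (g : L ≃ₐ[K] L) (h h' : H) :
    S.coeff g (h * h') = ∑ a, S.coeff a h * a (S.coeff (a⁻¹ * g) h') := by
  refine S.coeff_eq_of_act (f := fun g => ∑ a, S.coeff a h * a (S.coeff (a⁻¹ * g) h'))
    (fun x => ?_) g
  rw [map_mul, Module.End.mul_apply, act_apply]
  simp only [act_apply, map_sum, map_mul, Finset.mul_sum, Finset.sum_mul]
  conv_rhs => rw [Finset.sum_comm]
  refine Finset.sum_congr rfl fun a _ => ?_
  refine Fintype.sum_equiv (Equiv.mulLeft a) _ _ fun b => ?_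
  simp [mul_assoc]

end HopfGaloisStructure

theorem sum_galois_of_cyclic_four {K L : Type*} [Field K] [Field L] [Algebra K L]
    [FiniteDimensional K L] {σ : L ≃ₐ[K] L} (hσ : ∀ g : L ≃ₐ[K] L, g = 1 ∨ g = σ ∨ g = σ ^ 2 ∨ g = σ ^ 3)
    (h4 : orderOf σ = 4) {M : Type*} [AddCommMonoid M] (f : (L ≃ₐ[K] L) → M) :
    ∑ g, f g = f 1 + f σ + f (σ ^ 2) + f (σ ^ 3) := by
  classical
  have hinj : Set.InjOn (fun k : ℕ => σ ^ k) (Finset.range 4 : Finset ℕ) := by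
    have := pow_injOn_Iio_orderOf (x := σ)
    rw [h4] at this
    simpa [Finset.coe_range] using this
  have huniv : (Finset.univ : Finset (L ≃ₐ[K] L)) = (Finset.range 4).image (fun k => σ ^ k) := by
    symm
    rw [Finset.eq_univ_iff_forall]
    intro g
    rw [Finset.mem_image]
    rcases hσ g with rfl | rfl | rfl | rfl
    exacts [⟨0, by simp⟩, ⟨1, by simp⟩, ⟨2, by simp⟩, ⟨3, by simp⟩]
  rw [huniv, Finset.sum_image hinj]
  simp [Finset.sum_range_succ]

/-! ### Recognising the classical structure -/

namespace HopfGaloisStructure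

variable {K L H : Type*} [Field K] [Field L] [Algebra K L] [Ring H] [HopfAlgebra K H]
variable [FiniteDimensional K L] [IsGalois K L] (S : HopfGaloisStructure K L H)

theorem coeff_ext {h h' : H} (e : ∀ g, S.coeff g h = S.coeff g h') : h = h' := by
  apply S.act_injective
  ext x
  rw [act_apply, act_apply]
  simp [e]

/-- If all coefficient functions are invariant under the Galois group, the structure is classical. -/
theorem isClassical_of_coeff_fixed (hfix : ∀ (τ g : L ≃ₐ[K] L) h, τ (S.coeff g h) = S.coeff g h) :
    S.IsClassical := by
  classical
  have := S.finiteDimensional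
  have hrat : ∀ g h, ∃ q : K, algebraMap K L q = S.coeff g h := fun g h =>
    IsGalois.mem_range_algebraMap_iff_fixed _ |>.2 fun τ => hfix τ g h
  choose q hq using hrat
  have hinj := FaithfulSMul.algebraMap_injective K L
  let Q : H →ₗ[K] ((L ≃ₐ[K] L) → K) :=
    { toFun := fun h g => q g h
      map_add' := fun h h' => by
        funext g; apply hinj; simp [hq]
      map_smul' := fun r h => by
        funext g; apply hinj
        simp only [hq, map_smul, RingHom.id_apply, Pi.smul_apply, smul_eq_mul, map_mul]
        rw [Algebra.smul_def] }
  have hQinj : Function.Injective Q := by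
    intro h h' e
    refine S.coeff_ext fun g => ?_
    rw [← hq, ← hq]
    exact congrArg _ (congrFun e g)
  have hrk : Module.finrank K H = Module.finrank K ((L ≃ₐ[K] L) → K) := by
    rw [Module.finrank_fintype_fun_eq_card, S.finrank_eq, ← Nat.card_eq_fintype_card,
      IsGalois.card_aut_eq_finrank]
  let QE := LinearEquiv.ofInjectiveOfFinrankEq Q hQinj hrk
  -- The basis of `H` dual to the coefficient functions: `n g` acts as `g`, and orthogonality of the
  -- coefficients under convolution makes it group-like.
  let n : (L ≃ₐ[K] L) → H := fun g => QE.symm (Pi.single g 1)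
  have hn : ∀ g g', S.coeff g' (n g) = if g' = g then 1 else 0 := by
    intro g g'
    rw [← hq]
    have : Q (n g) = Pi.single g 1 := QE.apply_symm_apply _
    have e := congrFun this g'
    change q g' (n g) = _ at e
    rw [e, Pi.single_apply]
    split_ifs <;> simp
  have hact : ∀ g x, S.act (n g) x = g x := by
    intro g x
    rw [act_apply]
    simp [hn]
  let N : (L ≃ₐ[K] L) →* H :=
    { toFun := n
      map_one' := S.act_injective (by ext x; simp [hact])
      map_mul' := fun g g' => S.act_injective (by ext x; simp [hact]) }
  let E : MonoidAlgebra K (L ≃ₐ[K] L) →ₐ[K] H := MonoidAlgebra.lift K H (L ≃ₐ[K] L) N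
  have hE : ∀ g, E (MonoidAlgebra.single g 1) = n g := fun g => by
    simp [E, N]
  have hsurj : Function.Surjective E := by
    intro h
    refine ⟨∑ g, MonoidAlgebra.single g (q g h), S.coeff_ext fun g' => ?_⟩
    have e1 : ∀ g, E (MonoidAlgebra.single g (q g h)) = q g h • n g := fun g => by
      rw [← hE, ← map_smul]
      congr 1
      simp
    simp only [map_sum, e1, map_smul]
    simp [hn, Algebra.smul_def, hq]
  have hbij : Function.Bijective E := by
    have hfr : Module.finrank K (MonoidAlgebra K (L ≃ₐ[K] L)) = Module.finrank K H := by
      rw [hrk]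
      exact LinearEquiv.finrank_eq
        ((MonoidAlgebra.coeffLinearEquiv K).trans (Finsupp.linearEquivFunOnFinite K K (L ≃ₐ[K] L)))
    have : FiniteDimensional K (MonoidAlgebra K (L ≃ₐ[K] L)) :=
      Module.finite_of_finrank_pos (by rw [hfr, S.finrank_eq]; exact Module.finrank_pos)
    exact ⟨(LinearMap.injective_iff_surjective_of_finrank_eq_finrank
      (f := E.toLinearMap) hfr).2 hsurj, hsurj⟩
  let B : Module.Basis (L ≃ₐ[K] L) K H := Module.Basis.ofEquivFun QE
  have hrepr : ∀ w : H ⊗[K] H, ∀ a b, algebraMap K L ((B.tensorProduct B).repr w (a, b)) =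
      TensorProduct.lift ((LinearMap.mul K L).compl₁₂ (S.coeff a) (S.coeff b)) w := by
    intro w a b
    induction w with
    | zero => simp
    | add x y hx hy => simp [hx, hy]
    | tmul x y =>
      have hB : ∀ h g, B.repr h g = q g h := fun h g => rfl
      simp [hB, hq, mul_comm]
  have hcomul : ∀ g, Coalgebra.comul (R := K) (n g) = n g ⊗ₜ[K] n g := by
    intro g
    apply (B.tensorProduct B).ext_elem
    rintro ⟨a, b⟩
    apply hinj
    rw [hrepr, hrepr, ← conv_apply, conv_coeff]
    by_cases hab : a = b
    · simp [hn, hab]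
    · rw [if_neg hab]
      by_cases ha : a = g
      · have : b ≠ g := fun hb => hab (ha.trans hb.symm)
        simp [hn, this]
      · simp [hn, ha]
  have hcounit : ∀ g, Coalgebra.counit (R := K) (n g) = 1 := by
    intro g
    apply hinj
    rw [← S.act_one, hact, map_one, map_one]
  refine ⟨BialgEquiv.ofAlgEquiv (AlgEquiv.ofBijective E hbij) ?_ ?_, fun g x => ?_⟩
  · ext g
    simp [hE, hcounit]
  · ext g
    simp [hE, hcomul]
  · change S.act (E (MonoidAlgebra.single g 1)) x = g x
    rw [hE, hact]

/-! ### Non-classical structures on cyclic quartic extensions -/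

section CyclicQuartic

variable {σ : L ≃ₐ[K] L}

theorem coeff_eq_zero_of_cyclic_four
    (hσ : ∀ g : L ≃ₐ[K] L, g = 1 ∨ g = σ ∨ g = σ ^ 2 ∨ g = σ ^ 3)
    (h4 : orderOf σ = 4) {x₀ x₁ x₂ x₃ : L}
    (hx : ∀ h, x₀ * S.coeff 1 h + x₁ * S.coeff σ h + x₂ * S.coeff (σ ^ 2) h +
      x₃ * S.coeff (σ ^ 3) h = 0) : x₀ = 0 ∧ x₁ = 0 ∧ x₂ = 0 ∧ x₃ = 0 := by
  classical
  have h01 : (1 : L ≃ₐ[K] L) ≠ σ := fun h => by rw [← h, orderOf_one] at h4; omega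
  have hp : ∀ i j : ℕ, i < j → j < 4 → σ ^ i ≠ σ ^ j := fun i j hij hj h => by
    have := pow_injOn_Iio_orderOf (x := σ) (by rw [h4]; exact hij.trans hj) (by rw [h4]; exact hj) h
    omega
  have h02 := hp 0 2 (by norm_num) (by norm_num)
  have h03 := hp 0 3 (by norm_num) (by norm_num)
  have h12 := hp 1 2 (by norm_num) (by norm_num)
  have h13 := hp 1 3 (by norm_num) (by norm_num)
  have h23 := hp 2 3 (by norm_num) (by norm_num)
  rw [pow_zero] at h02 h03
  rw [pow_one] at h12 h13
  let m : (L ≃ₐ[K] L) → L := fun g =>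
    if g = 1 then x₀ else if g = σ then x₁ else if g = σ ^ 2 then x₂ else x₃
  have h0 : m 1 = x₀ := by simp [m]
  have h1 : m σ = x₁ := by simp [m, h01.symm]
  have h2 : m (σ ^ 2) = x₂ := by simp only [m, h02.symm, h12.symm, if_false, if_true]
  have h3 : m (σ ^ 3) = x₃ := by simp only [m, h03.symm, h13.symm, h23.symm, if_false]
  have := Fintype.linearIndependent_iff.1 S.linearIndependent_coeff m (by
    rw [sum_galois_of_cyclic_four hσ h4, h0, h1, h2, h3]
    ext h
    simpa using hx h)
  exact ⟨h0 ▸ this 1, h1 ▸ this σ, h2 ▸ this (σ ^ 2), h3 ▸ this (σ ^ 3)⟩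

/-- In a non-classical Hopf-Galois structure on a cyclic quartic extension, a generator of the
Galois group exchanges the coefficients of itself and its inverse, and fixes the other two. -/
theorem coeff_of_not_isClassical
    (hσ : ∀ g : L ≃ₐ[K] L, g = 1 ∨ g = σ ∨ g = σ ^ 2 ∨ g = σ ^ 3)
    (h4 : orderOf σ = 4) (hS : ¬ S.IsClassical) (h : H) :
    σ (S.coeff 1 h) = S.coeff 1 h ∧ σ (S.coeff σ h) = S.coeff (σ ^ 3) h ∧
    σ (S.coeff (σ ^ 2) h) = S.coeff (σ ^ 2) h ∧ σ (S.coeff (σ ^ 3) h) = S.coeff σ h := by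
  classical
  have hσ4 : σ ^ 4 = 1 := h4 ▸ pow_orderOf_eq_one σ
  obtain ⟨π, hπ⟩ := S.exists_perm σ
  have hπ1 : π 1 = 1 := by
    by_contra hne
    have := hπ 1 1
    rw [S.coeff_one, S.coeff_one, if_pos rfl, if_neg hne, map_one] at this
    exact one_ne_zero this
  have hind := fun x₀ x₁ x₂ x₃ => S.coeff_eq_zero_of_cyclic_four (x₀ := x₀) (x₁ := x₁) (x₂ := x₂)
    (x₃ := x₃) hσ h4
  have hc0 : ∀ h, σ (S.coeff 1 h) = S.coeff 1 h := fun h => by rw [hπ, hπ1]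
  have hinv1 : σ⁻¹ = σ ^ 3 := inv_eq_of_mul_eq_one_right (by rw [← pow_succ', hσ4])
  have hinv2 : (σ ^ 2)⁻¹ = σ ^ 2 := inv_eq_of_mul_eq_one_right (by rw [← pow_add, hσ4])
  have hinv3 : (σ ^ 3)⁻¹ = σ := inv_eq_of_mul_eq_one_right (by rw [← pow_succ, hσ4])
  have hp2 : ∀ x, (σ ^ 2) x = σ (σ x) := fun x => rfl
  have hp3 : ∀ x, (σ ^ 3) x = σ (σ (σ x)) := fun x => rfl
  have hp4 : ∀ x, σ (σ (σ (σ x))) = x := fun x => by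
    change (σ ^ 4) x = x
    rw [hσ4]; rfl
  have hmul : ∀ h h', S.coeff 1 (h * h') = S.coeff 1 h * S.coeff 1 h' +
      S.coeff σ h * σ (S.coeff (σ ^ 3) h') + S.coeff (σ ^ 2) h * (σ ^ 2) (S.coeff (σ ^ 2) h') +
      S.coeff (σ ^ 3) h * (σ ^ 3) (S.coeff σ h') := by
    intro h h'
    rw [coeff_mul, sum_galois_of_cyclic_four hσ h4]
    simp only [mul_one, inv_one, hinv1, hinv2, hinv3]
    rfl
  -- The identity coefficient of a product is also fixed by `σ`; expanding it constrains how `π`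
  -- acts on the other three coefficients.
  have hmulσ := fun h h' => hc0 (h * h')
  simp only [hmul, map_add, map_mul, hp2, hp3, hc0, hp4] at hmulσ
  have hπinj : ∀ g g', π g = π g' → g = g' := fun g g' h => π.injective h
  have h1 : σ ≠ 1 := fun h => by rw [h, orderOf_one] at h4; omega
  have h2 : σ ^ 2 ≠ 1 := fun h => by
    have := orderOf_dvd_of_pow_eq_one h
    rw [h4] at this; omega
  have h3 : σ ^ 3 ≠ 1 := fun h => by
    have := orderOf_dvd_of_pow_eq_one h
    rw [h4] at this; omega
  have h21 : σ ^ 2 ≠ σ := fun h => h1 (by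
    rw [pow_two] at h
    exact mul_eq_left.1 h)
  have h32 : σ ^ 3 ≠ σ ^ 2 := fun h => h1 (by
    rw [pow_succ] at h
    exact mul_eq_left.1 h)
  have h31 : σ ^ 3 ≠ σ := fun h => h2 (by
    rw [pow_succ] at h
    exact mul_eq_right.1 h)
  have hc1 := hπ σ
  have hc2 := hπ (σ ^ 2)
  have hc3 := hπ (σ ^ 3)
  have hne12 := fun e => h21 (hπinj _ _ e)
  have hne13 := fun e => h31 (hπinj _ _ e)
  have hne23 := fun e => h32 (hπinj _ _ e)
  have hn1 : π σ ≠ 1 := fun e => h1 (hπinj _ _ (e.trans hπ1.symm))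
  have hn2 : π (σ ^ 2) ≠ 1 := fun e => h2 (hπinj _ _ (e.trans hπ1.symm))
  have hn3 : π (σ ^ 3) ≠ 1 := fun e => h3 (hπinj _ _ (e.trans hπ1.symm))
  rcases hσ (π σ) with e1 | e1 | e1 | e1 <;> rw [e1] at hc1 hne12 hne13 hn1 <;>
  rcases hσ (π (σ ^ 2)) with e2 | e2 | e2 | e2 <;> rw [e2] at hc2 hne12 hne23 hn2 <;>
  rcases hσ (π (σ ^ 3)) with e3 | e3 | e3 | e3 <;> rw [e3] at hc3 hne13 hne23 hn3
  all_goals first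
    | exact absurd rfl hn1
    | exact absurd rfl hn2
    | exact absurd rfl hn3
    | exact absurd rfl hne12
    | exact absurd rfl hne13
    | exact absurd rfl hne23
    | skip
  · refine absurd (S.isClassical_of_coeff_fixed fun τ g h => ?_) hS
    have hg : σ (S.coeff g h) = S.coeff g h := by
      rcases hσ g with rfl | rfl | rfl | rfl
      exacts [hc0 h, hc1 h, hc2 h, hc3 h]
    rcases hσ τ with rfl | rfl | rfl | rfl
    · rfl
    · exact hg
    · rw [hp2, hg, hg]
    · rw [hp3, hg, hg, hg]
  -- A transposition moving `σ ^ 2` contradicts `hmulσ`: independence in `h`, with `h'` fixed,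
  -- identifies two distinct coefficient functions. The next case is similar.
  · simp only [hc1, hc2, hc3] at hmulσ
    have key : ∀ h', S.coeff (σ ^ 3) h' - S.coeff (σ ^ 2) h' = 0 := fun h' =>
      (hind 0 _ (S.coeff σ h' - S.coeff (σ ^ 2) h')
        (S.coeff (σ ^ 3) h' - S.coeff σ h') fun h => by
          linear_combination hmulσ h h').2.1
    have := (hind 0 0 (-1) 1 fun h => by linear_combination key h).2.2.2
    exact absurd this one_ne_zero
  · simp only [hc1, hc2, hc3] at hmulσ
    have key : ∀ h', S.coeff σ h' - S.coeff (σ ^ 3) h' = 0 := fun h' =>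
      (hind 0 _ (S.coeff (σ ^ 3) h' - S.coeff (σ ^ 2) h')
        (S.coeff σ h' - S.coeff (σ ^ 2) h') fun h => by
          linear_combination hmulσ h h').2.1
    have := (hind 0 1 0 (-1) fun h => by linear_combination key h).2.1
    exact absurd this one_ne_zero
  · have := (hind 0 1 (-1) 0 fun h => by
      have := hp4 (S.coeff σ h)
      rw [hc1, hc2, hc3, hc1] at this
      linear_combination -this).2.1
    exact absurd this one_ne_zero
  · have := (hind 0 1 0 (-1) fun h => by
      have := hp4 (S.coeff σ h)
      rw [hc1, hc3, hc2, hc1] at this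
      linear_combination -this).2.1
    exact absurd this one_ne_zero
  · exact ⟨hc0 h, hc1 h, hc2 h, hc3 h⟩

end CyclicQuartic

end HopfGaloisStructure

/-- Generators of a cyclic quartic field `L = ℚ(u)`, `u² = A (d + b s)`, `s² = d = b² + c²`, with
a generator `σ` of the Galois group and the conjugate `v = σ u` of `u`. -/
structure CyclicQuarticFrame (L : Type*) [Field L] [NumberField L] (A : ℤ) (b c d : ℕ) where
  σ : L ≃ₐ[ℚ] L
  s : L
  u : L
  v : L
  sigma_s : σ s = -s
  sigma_u : σ u = v
  sigma_v : σ v = -u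
  s_sq : s ^ 2 = d
  u_sq : u ^ 2 = A * (d + b * s)
  s_mul_u : s * u = b * u + c * v
  s_ne_zero : s ≠ 0
  u_ne_zero : u ≠ 0
  span : ∀ x : L, ∃ p q r t : ℚ, x = p + q * s + r * u + t * v

/-! ### Multiplication and automorphisms in a cyclic quartic frame -/

namespace CyclicQuarticFrame

variable {L : Type*} [Field L] [NumberField L] {A : ℤ} {b c d : ℕ}
  (F : CyclicQuarticFrame L A b c d)

theorem s_mul_v : F.s * F.v = c * F.u - b * F.v := by
  have h := congrArg F.σ F.s_mul_u
  simp only [map_mul, map_add, map_natCast, F.sigma_s, F.sigma_u, F.sigma_v] at h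
  linear_combination -h

theorem v_sq : F.v ^ 2 = A * (d - b * F.s) := by
  have h := congrArg F.σ F.u_sq
  simp only [map_mul, map_add, map_natCast, map_intCast, map_pow, F.sigma_s, F.sigma_u] at h
  linear_combination h

theorem u_mul_v (hd : d = b ^ 2 + c ^ 2) (hc : c ≠ 0) : F.u * F.v = A * c * F.s := by
  have hc' : (c : L) ≠ 0 := Nat.cast_ne_zero.2 hc
  have hd' : (d : L) = b ^ 2 + c ^ 2 := by exact_mod_cast congrArg (Nat.cast : ℕ → L) hd
  apply mul_left_cancel₀ hc'
  linear_combination (-F.u) * F.s_mul_u + (F.s - b) * F.u_sq + A * b * F.s_sq + A * F.s * hd'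

theorem rat_eq_zero_of_add_mul_s {p q : ℚ} (h : (p : L) + q * F.s = 0) : p = 0 ∧ q = 0 := by
  have h' := congrArg F.σ h
  simp only [map_mul, map_add, map_ratCast, F.sigma_s, map_zero] at h'
  have hp : (p : L) = 0 := by linear_combination (h + h') / 2
  have hq : (q : L) = 0 := by
    apply mul_right_cancel₀ F.s_ne_zero
    linear_combination (h - h') / 2
  exact ⟨by exact_mod_cast hp, by exact_mod_cast hq⟩

theorem rat_ext_s {p q p' q' : ℚ} (h : (p : L) + q * F.s = p' + q' * F.s) : p = p' ∧ q = q' := by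
  have := F.rat_eq_zero_of_add_mul_s (p := p - p') (q := q - q') (by
    push_cast; linear_combination h)
  exact ⟨sub_eq_zero.1 this.1, sub_eq_zero.1 this.2⟩

theorem rat_eq_zero_of_add_mul_v (hc : c ≠ 0) {r t : ℚ} (h : (r : L) * F.u + t * F.v = 0) :
    r = 0 ∧ t = 0 := by
  have h1 : ((r * c - t * b : ℚ) : L) + (t : ℚ) * F.s = 0 := by
    apply mul_right_cancel₀ F.u_ne_zero
    push_cast
    linear_combination c * h + t * F.s_mul_u
  obtain ⟨h2, rfl⟩ := F.rat_eq_zero_of_add_mul_s h1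
  refine ⟨?_, rfl⟩
  rw [zero_mul, sub_zero] at h2
  exact (mul_eq_zero.1 h2).resolve_right (Nat.cast_ne_zero.2 hc)

theorem rat_ext_v (hc : c ≠ 0) {r t r' t' : ℚ}
    (h : (r : L) * F.u + t * F.v = r' * F.u + t' * F.v) : r = r' ∧ t = t' := by
  have := F.rat_eq_zero_of_add_mul_v hc (r := r - r') (t := t - t') (by
    push_cast; linear_combination h)
  exact ⟨sub_eq_zero.1 this.1, sub_eq_zero.1 this.2⟩

theorem algEquiv_ext {g g' : L ≃ₐ[ℚ] L} (hs : g F.s = g' F.s) (hu : g F.u = g' F.u)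
    (hv : g F.v = g' F.v) : g = g' := by
  ext x
  obtain ⟨p, q, r, t, rfl⟩ := F.span x
  simp [hs, hu, hv]

theorem sigma_pow_four : F.σ ^ 4 = 1 := by
  apply F.algEquiv_ext
  · change F.σ (F.σ (F.σ (F.σ F.s))) = F.s
    simp [F.sigma_s]
  · change F.σ (F.σ (F.σ (F.σ F.u))) = F.u
    simp [F.sigma_u, F.sigma_v]
  · change F.σ (F.σ (F.σ (F.σ F.v))) = F.v
    simp [F.sigma_u, F.sigma_v]

theorem orderOf_sigma : orderOf F.σ = 4 := by
  refine orderOf_eq_prime_pow (p := 2) (n := 1) (fun h => F.u_ne_zero ?_) F.sigma_pow_four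
  have : F.σ (F.σ F.u) = F.u := by
    change (F.σ ^ 2) F.u = F.u
    rw [show F.σ ^ 2 = 1 from h]; rfl
  rw [F.sigma_u, F.sigma_v] at this
  linear_combination -this / 2

theorem eq_sigma_pow (hc : c ≠ 0) (g : L ≃ₐ[ℚ] L) :
    g = 1 ∨ g = F.σ ∨ g = F.σ ^ 2 ∨ g = F.σ ^ 3 := by
  have hc' : (c : L) ≠ 0 := Nat.cast_ne_zero.2 hc
  have key : ∀ g : L ≃ₐ[ℚ] L, g F.s = F.s → g = 1 ∨ g = F.σ ^ 2 := by
    intro g hg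
    have h1 := congrArg g F.u_sq
    simp only [map_mul, map_add, map_natCast, map_intCast, map_pow, hg] at h1
    rw [← F.u_sq] at h1
    have h2 := congrArg g F.s_mul_u
    simp only [map_mul, map_add, map_natCast, hg] at h2
    rcases sq_eq_sq_iff_eq_or_eq_neg.1 h1 with h | h
    · left
      refine F.algEquiv_ext hg h (mul_left_cancel₀ hc' ?_)
      rw [h] at h2
      change _ = c * F.v
      linear_combination F.s_mul_u - h2
    · right
      refine F.algEquiv_ext ?_ ?_ (mul_left_cancel₀ hc' ?_)
      · change _ = F.σ (F.σ F.s)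
        simp [F.sigma_s, hg]
      · change _ = F.σ (F.σ F.u)
        rw [F.sigma_u, F.sigma_v, h]
      · change _ = c * F.σ (F.σ F.v)
        rw [F.sigma_v, map_neg, F.sigma_u]
        rw [h] at h2
        linear_combination -F.s_mul_u - h2
  have hgs : g F.s = F.s ∨ g F.s = -F.s := by
    apply sq_eq_sq_iff_eq_or_eq_neg.1
    rw [← map_pow, F.s_sq, map_natCast]
  rcases hgs with h | h
  · rcases key g h with h | h <;> simp [h]
  · have h' : F.σ ^ 4 = 1 := F.sigma_pow_four
    rcases key (F.σ * g) (by simp [h, F.sigma_s]) with h | h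
    · right; right; right
      rw [eq_inv_of_mul_eq_one_right h, inv_eq_of_mul_eq_one_right]
      rw [← pow_succ', h']
    · right; left
      rw [pow_two] at h
      exact mul_left_cancel h

/-- The frame obtained by replacing `u` by `u + v` and `b + c i` by `c + b i`. -/
def swap (hd : d = b ^ 2 + c ^ 2) (hc : c ≠ 0) : CyclicQuarticFrame L (2 * A) c b d where
  σ := F.σ⁻¹
  s := F.s
  u := F.u + F.v
  v := F.u - F.v
  sigma_s := by
    change F.σ.symm F.s = _
    rw [AlgEquiv.symm_apply_eq, map_neg, F.sigma_s, neg_neg]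
  sigma_u := by
    change F.σ.symm _ = _
    rw [AlgEquiv.symm_apply_eq, map_sub, F.sigma_u, F.sigma_v]
    ring
  sigma_v := by
    change F.σ.symm _ = _
    rw [AlgEquiv.symm_apply_eq, map_neg, map_add, F.sigma_u, F.sigma_v]
    ring
  s_sq := F.s_sq
  u_sq := by
    push_cast
    linear_combination F.u_sq + F.v_sq + 2 * F.u_mul_v hd hc
  s_mul_u := by linear_combination F.s_mul_u + F.s_mul_v
  s_ne_zero := F.s_ne_zero
  u_ne_zero := by
    intro h
    have := (F.rat_eq_zero_of_add_mul_v hc (r := 1) (t := 1) (by push_cast; linear_combination h)).1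
    exact one_ne_zero this
  span := by
    intro x
    obtain ⟨p, q, r, t, rfl⟩ := F.span x
    refine ⟨p, q, (r + t) / 2, (r - t) / 2, ?_⟩
    push_cast
    ring

end CyclicQuarticFrame

/-! ### Existence of the frame -/

section Existence

variable {L : Type*} [Field L] [NumberField L]

/-- The conjugate root `w = z(s - e)/f` already lies in `L`, so a rational quartic vanishing at `z`
splits as `(X² - z²)(X² - w²)`. -/
theorem isGalois_of_adjoin_sqrt (a : ℤ) (e f d : ℕ) (s z : L) (hf : f ≠ 0)
    (hd : d = e ^ 2 + f ^ 2) (hs : s ^ 2 = (d : L)) (hz : z ^ 2 = (a : L) * ((d : L) + (e : L) * s))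
    (hL : IntermediateField.adjoin ℚ {z} = ⊤) : IsGalois ℚ L := by
  have hf' : (f : L) ≠ 0 := Nat.cast_ne_zero.2 hf
  have hd' : (d : L) = e ^ 2 + f ^ 2 := by exact_mod_cast congrArg (Nat.cast : ℕ → L) hd
  set w := z * (s - e) / f with hw
  have hw' : f * w = z * (s - e) := by rw [hw]; field_simp
  have hw2 : w ^ 2 = a * (d - e * s) := by
    apply mul_left_cancel₀ (pow_ne_zero 2 hf')
    rw [← mul_pow, hw']
    linear_combination (s - e) ^ 2 * hz + a * (-(s - e) ^ 2 + (s - e) * s + f ^ 2) * hs +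
      a * (s - e) * s * hd'
  let P : Polynomial ℚ := Polynomial.X ^ 4 - Polynomial.C (2 * a * d : ℚ) * Polynomial.X ^ 2 +
    Polynomial.C (a ^ 2 * (d ^ 2 - e ^ 2 * d) : ℚ)
  have hP : P.map (algebraMap ℚ L) = (Polynomial.X - Polynomial.C z) *
      (Polynomial.X - Polynomial.C (-z)) * ((Polynomial.X - Polynomial.C w) *
      (Polynomial.X - Polynomial.C (-w))) := by
    have e1 : (Polynomial.X - Polynomial.C z) * (Polynomial.X - Polynomial.C (-z)) =
        Polynomial.X ^ 2 - Polynomial.C (z ^ 2) := by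
      rw [Polynomial.C_neg, Polynomial.C_pow]; ring
    have e2 : (Polynomial.X - Polynomial.C w) * (Polynomial.X - Polynomial.C (-w)) =
        Polynomial.X ^ 2 - Polynomial.C (w ^ 2) := by
      rw [Polynomial.C_neg, Polynomial.C_pow]; ring
    have e3 : (2 * a * d : L) = z ^ 2 + w ^ 2 := by rw [hz, hw2]; ring
    have e4 : (a ^ 2 * (d ^ 2 - e ^ 2 * d) : L) = z ^ 2 * w ^ 2 := by
      rw [hz, hw2]; linear_combination a ^ 2 * e ^ 2 * hs
    rw [e1, e2]
    simp only [P, Polynomial.map_add, Polynomial.map_sub, Polynomial.map_mul, Polynomial.map_pow,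
      Polynomial.map_X, Polynomial.map_C]
    have e3' : algebraMap ℚ L (2 * a * d) = z ^ 2 + w ^ 2 := by rw [← e3]; simp
    have e4' : algebraMap ℚ L (a ^ 2 * (d ^ 2 - e ^ 2 * d)) = z ^ 2 * w ^ 2 := by rw [← e4]; simp
    rw [e3', e4', Polynomial.C_add, Polynomial.C_mul]
    ring
  have hsplit : ((minpoly ℚ z).map (algebraMap ℚ L)).Splits := by
    have hdvd : minpoly ℚ z ∣ P := minpoly.dvd ℚ z (by
      rw [Polynomial.aeval_def, ← Polynomial.eval_map, hP]
      simp)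
    refine Polynomial.Splits.of_dvd (g := P.map (algebraMap ℚ L)) ?_ ?_
      (Polynomial.map_dvd _ hdvd)
    · rw [hP]
      exact ((Polynomial.Splits.X_sub_C _).mul (Polynomial.Splits.X_sub_C _)).mul
        ((Polynomial.Splits.X_sub_C _).mul (Polynomial.Splits.X_sub_C _))
    · rw [hP]
      simp only [ne_eq, mul_eq_zero, Polynomial.X_sub_C_ne_zero, or_self, not_false_eq_true]
  have hnormal : Normal ℚ L :=
    { splits' := fun x => IntermediateField.splits_of_mem_adjoin ℚ L (S := {z}) (fun y hy => by
        obtain rfl := Set.mem_singleton_iff.1 hy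
        exact ⟨Algebra.IsIntegral.isIntegral y, hsplit⟩) (by rw [hL]; trivial) }
  exact ⟨⟩

theorem not_isSquare_rat_of_squarefree {d : ℕ} (hd : Squarefree d) (h1 : 1 < d) (q : ℚ) :
    q ^ 2 ≠ d := by
  intro h
  have : IsSquare ((d : ℕ) : ℚ) := ⟨q, by rw [← h]; ring⟩
  rw [Rat.isSquare_natCast_iff] at this
  obtain ⟨r, hr⟩ := this
  have := Nat.isUnit_iff.1 (hd r ⟨1, by rw [hr]; ring⟩)
  subst this
  omega

theorem exists_cyclicQuarticFrame (a : ℤ) (e f d : ℕ) (s z : L) (ha : a ≠ 0) (he : e ≠ 0)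
    (hf : f ≠ 0) (hd : d = e ^ 2 + f ^ 2) (hsq : Squarefree d) (hs : s ^ 2 = (d : L))
    (hz : z ^ 2 = (a : L) * ((d : L) + (e : L) * s))
    (hL : IntermediateField.adjoin ℚ {z} = ⊤) :
    Nonempty (CyclicQuarticFrame L a e f d) := by
  have hG := isGalois_of_adjoin_sqrt a e f d s z hf hd hs hz hL
  have hf' : (f : L) ≠ 0 := Nat.cast_ne_zero.2 hf
  have he' : (e : L) ≠ 0 := Nat.cast_ne_zero.2 he
  have ha' : (a : L) ≠ 0 := Int.cast_ne_zero.2 ha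
  have hd' : (d : L) = e ^ 2 + f ^ 2 := by exact_mod_cast congrArg (Nat.cast : ℕ → L) hd
  have h1d : 1 < d := by
    have := Nat.pos_of_ne_zero (pow_ne_zero 2 he)
    have := Nat.pos_of_ne_zero (pow_ne_zero 2 hf)
    omega
  have hirr : ∀ q : ℚ, (q : L) ≠ s := fun q hq =>
    not_isSquare_rat_of_squarefree hsq h1d q (by
      rw [← hq] at hs
      exact_mod_cast hs)
  have hs0 : s ≠ 0 := fun h => hirr 0 (by simp [h])
  have hz0 : z ≠ 0 := by
    intro h
    rw [h] at hz
    refine hirr (-d / e) ?_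
    push_cast
    field_simp
    apply mul_left_cancel₀ ha'
    linear_combination hz
  set w := z * (s - e) / f with hw
  have hw' : f * w = z * (s - e) := by rw [hw]; field_simp
  have hw2 : w ^ 2 = a * (d - e * s) := by
    apply mul_left_cancel₀ (pow_ne_zero 2 hf')
    rw [← mul_pow, hw']
    linear_combination (s - e) ^ 2 * hz + a * (-(s - e) ^ 2 + (s - e) * s + f ^ 2) * hs +
      a * (s - e) * s * hd'
  obtain ⟨τ, hτ⟩ : ∃ τ : L ≃ₐ[ℚ] L, τ s ≠ s := by
    by_contra! hall
    obtain ⟨q, hq⟩ := (IsGalois.mem_range_algebraMap_iff_fixed (F := ℚ) s).2 hall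
    exact hirr q (by simpa using hq)
  have hτs : τ s = -s := by
    have : (τ s) ^ 2 = s ^ 2 := by rw [← map_pow, hs, map_natCast]
    exact (sq_eq_sq_iff_eq_or_eq_neg.1 this).resolve_left hτ
  have hτz : τ z = w ∨ τ z = -w := by
    apply sq_eq_sq_iff_eq_or_eq_neg.1
    rw [← map_pow, hz, hw2]
    simp only [map_mul, map_add, map_natCast, map_intCast, hτs]
    ring
  -- If `τ z = -w`, then `τ⁻¹` sends `z` to `w`, so the sign can always be normalised.
  have hσ : ∃ σ : L ≃ₐ[ℚ] L, σ s = -s ∧ σ z = w := by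
    rcases hτz with h | h
    · exact ⟨τ, hτs, h⟩
    · refine ⟨τ.symm, ?_, ?_⟩
      · rw [AlgEquiv.symm_apply_eq, map_neg, hτs, neg_neg]
      · rw [AlgEquiv.symm_apply_eq]
        apply mul_left_cancel₀ hf'
        have h2 := congrArg τ hw'
        simp only [map_mul, map_sub, map_natCast, hτs, h] at h2
        apply mul_left_cancel₀ hf'
        linear_combination -(f : L) * h2 - (s + e) * hw' - z * hs - z * hd'
  obtain ⟨σ, hσs, hσz⟩ := hσ
  have hsz : s * z = e * z + f * w := by linear_combination -hw'
  have hsw : s * w = f * z - e * w := by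
    apply mul_left_cancel₀ hf'
    linear_combination (s + e) * hw' + z * hs + z * hd'
  have hzw : z * w = a * f * s := by
    apply mul_left_cancel₀ hf'
    linear_combination z * hw' + (s - e) * hz + a * e * hs + a * s * hd'
  have hσw : σ w = -z := by
    apply mul_left_cancel₀ hf'
    have h2 := congrArg σ hw'
    simp only [map_mul, map_sub, map_natCast, hσs, hσz] at h2
    linear_combination h2 - hsw
  refine ⟨⟨σ, s, z, w, hσs, hσz, hσw, hs, hz, hsz, hs0, hz0, ?_⟩⟩
  intro x
  have hx : x ∈ Algebra.adjoin ℚ {z} := by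
    have h1 : x ∈ IntermediateField.adjoin ℚ {z} := by rw [hL]; trivial
    rwa [← IntermediateField.mem_toSubalgebra,
      IntermediateField.adjoin_simple_toSubalgebra_of_isAlgebraic
        (Algebra.IsAlgebraic.isAlgebraic z)] at h1
  induction hx using Algebra.adjoin_induction with
  | mem y hy =>
    rw [Set.mem_singleton_iff.1 hy]
    exact ⟨0, 0, 1, 0, by simp⟩
  | algebraMap q => exact ⟨q, 0, 0, 0, by simp⟩
  | add x y _ _ hx hy =>
    obtain ⟨p, q, r, t, rfl⟩ := hx
    obtain ⟨p', q', r', t', rfl⟩ := hy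
    exact ⟨p + p', q + q', r + r', t + t', by push_cast; ring⟩
  | mul x y _ _ hx hy =>
    obtain ⟨p, q, r, t, rfl⟩ := hx
    obtain ⟨p', q', r', t', rfl⟩ := hy
    refine ⟨p * p' + q * q' * d + a * d * (r * r' + t * t'),
      p * q' + q * p' + a * e * (r * r' - t * t') + a * f * (r * t' + t * r'),
      p * r' + r * p' + e * (q * r' + r * q') + f * (q * t' + t * q'),
      p * t' + t * p' + f * (q * r' + r * q') - e * (q * t' + t * q'), ?_⟩
    push_cast
    linear_combination (q * q') * hs + (r * r') * hz + (t * t') * hw2 + (r * t' + t * r') * hzw +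
      (q * r' + r * q') * hsz + (q * t' + t * q') * hsw

end Existence

/-! ### Criteria for integrality -/

theorem exists_int_of_squarefree_mul_sq {D : ℤ} (hD : Squarefree D) {q : ℚ} {n : ℤ}
    (h : D * q ^ 2 = n) : ∃ k : ℤ, q = k := by
  have hden : (q.den : ℚ) ≠ 0 := Nat.cast_ne_zero.2 q.den_nz
  have h1 : D * q.num ^ 2 = n * (q.den : ℤ) ^ 2 := by
    have : (D : ℚ) * q.num ^ 2 = n * (q.den : ℚ) ^ 2 := by
      rw [← h, ← Rat.num_div_den q]
      simp only [Rat.num_div_den]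
      nth_rw 2 [← Rat.num_div_den q]
      field_simp
    exact_mod_cast this
  have hcop : IsCoprime ((q.den : ℤ) ^ 2) (q.num ^ 2) :=
    (Int.isCoprime_iff_gcd_eq_one.2 (by
      rw [Int.gcd_comm]; exact q.reduced)).pow
  have hdvd : (q.den : ℤ) ^ 2 ∣ D := hcop.dvd_of_dvd_mul_right (Dvd.intro_left _ h1.symm)
  have hu := hD (q.den : ℤ) (by rwa [← pow_two])
  have h1 : q.den = 1 := by
    have := Int.isUnit_iff.1 hu
    omega
  exact ⟨q.num, (Rat.den_eq_one_iff q).1 h1 |>.symm⟩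

theorem even_and_even_of_four_dvd {x y : ℤ} (h : 4 ∣ x ^ 2 + y ^ 2) : Even x ∧ Even y := by
  obtain ⟨k, hk⟩ := h
  rcases Int.even_or_odd' x with ⟨i, rfl | rfl⟩ <;> rcases Int.even_or_odd' y with ⟨j, rfl | rfl⟩
  · exact ⟨even_two_mul _, even_two_mul _⟩
  all_goals
    exfalso
    ring_nf at hk
    omega

/-- The number `n` is the real part of `a(b - ci)(R + iT)²`. Its imaginary part `k` satisfies `m² =
d(n² + k²)`, so `k` is an integer and `d` divides `m`. Sums and differences then bound the
denominators of `R` and `T` by 2, and oddness of `a` removes the 2. -/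
theorem exists_int_of_norm_forms {a b c d : ℤ} (ha : Odd a) (hsq : Squarefree (a * d))
    (hd : d = b ^ 2 + c ^ 2) {R T : ℚ} {m n : ℤ}
    (hm : a * d * (R ^ 2 + T ^ 2) = m) (hn : a * (b * (R ^ 2 - T ^ 2) + 2 * c * R * T) = n) :
    ∃ x y : ℤ, R = x ∧ T = y := by
  have hdQ : (d : ℚ) = b ^ 2 + c ^ 2 := by exact_mod_cast hd
  have hsqd : Squarefree d := hsq.of_mul_right
  have ha0 : (a : ℚ) ≠ 0 := Int.cast_ne_zero.2 fun h => by simp [h] at ha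
  have hd0 : (d : ℚ) ≠ 0 := Int.cast_ne_zero.2 hsqd.ne_zero
  obtain ⟨k, hk⟩ := exists_int_of_squarefree_mul_sq hsqd
    (q := a * (2 * b * R * T - c * (R ^ 2 - T ^ 2))) (n := m ^ 2 - d * n ^ 2) (by
      push_cast
      rw [← hm, ← hn]
      linear_combination (-(d : ℚ) * a ^ 2 * (R ^ 2 + T ^ 2) ^ 2) * hdQ)
  have hmk : m ^ 2 = d * (n ^ 2 + k ^ 2) := by
    have : (m : ℚ) ^ 2 = d * (n ^ 2 + k ^ 2) := by
      rw [← hm, ← hn, ← hk]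
      linear_combination ((d : ℚ) * a ^ 2 * (R ^ 2 + T ^ 2) ^ 2) * hdQ
    exact_mod_cast this
  obtain ⟨m', rfl⟩ : d ∣ m := (hsqd.dvd_pow_iff_dvd two_ne_zero).1 (Dvd.intro _ hmk.symm)
  have hm' : a * (R ^ 2 + T ^ 2) = m' := by
    apply mul_left_cancel₀ hd0
    push_cast at hm
    linear_combination hm
  have hdiff : a * d * (R ^ 2 - T ^ 2) = b * n - c * k := by
    rw [← hn, ← hk, hdQ]; ring
  obtain ⟨x, hx⟩ := exists_int_of_squarefree_mul_sq hsq (q := 2 * R)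
    (n := 2 * (d * m' + (b * n - c * k))) (by
      push_cast at hm ⊢
      linear_combination 2 * hm + 2 * hdiff)
  obtain ⟨y, hy⟩ := exists_int_of_squarefree_mul_sq hsq (q := 2 * T)
    (n := 2 * (d * m' - (b * n - c * k))) (by
      push_cast at hm ⊢
      linear_combination 2 * hm - 2 * hdiff)
  have hxy : a * (x ^ 2 + y ^ 2) = 4 * m' := by
    have : (a : ℚ) * (x ^ 2 + y ^ 2) = 4 * m' := by
      rw [← hx, ← hy]; linear_combination 4 * hm'
    exact_mod_cast this
  have hcop : IsCoprime (4 : ℤ) a := by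
    obtain ⟨k, rfl⟩ := ha
    have : IsCoprime (2 : ℤ) (2 * k + 1) := ⟨-k, 1, by ring⟩
    simpa using this.pow_left (m := 2)
  obtain ⟨⟨x', rfl⟩, ⟨y', rfl⟩⟩ := even_and_even_of_four_dvd
    (hcop.dvd_of_dvd_mul_left (Dvd.intro _ hxy.symm))
  push_cast at hx hy
  exact ⟨x', y', by linarith, by linarith⟩

theorem isIntegral_of_sq_eq {L : Type*} [Field L] {α β y : L} (hα : IsIntegral ℤ α)
    (hβ : IsIntegral ℤ β) (h : y ^ 2 = α * y + β) : IsIntegral ℤ y := by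
  let O := integralClosure ℤ L
  have : IsIntegral O y := by
    refine ⟨Polynomial.X ^ 2 - (Polynomial.C (⟨α, hα⟩ : O) * Polynomial.X + Polynomial.C (⟨β, hβ⟩ : O)), ?_, ?_⟩
    · exact Polynomial.monic_X_pow_sub (by
        exact lt_of_le_of_lt Polynomial.degree_linear_le (by norm_num))
    · simp only [Polynomial.eval₂_sub, Polynomial.eval₂_add, Polynomial.eval₂_mul,
        Polynomial.eval₂_pow, Polynomial.eval₂_X, Polynomial.eval₂_C]
      rw [h]
      change α * y + β - (α * y + β) = 0
      ring
  exact isIntegral_trans (R := ℤ) (A := O) y this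

theorem isIntegral_ratCast_iff {L : Type*} [Field L] [NumberField L] {q : ℚ} :
    IsIntegral ℤ (q : L) ↔ ∃ n : ℤ, q = n := by
  have : (q : L) = algebraMap ℚ L q := by simp
  rw [this, isIntegral_algebraMap_iff (FaithfulSMul.algebraMap_injective ℚ L),
    IsIntegrallyClosed.isIntegral_iff]
  simp [eq_comm]

namespace CyclicQuarticFrame

variable {L : Type*} [Field L] [NumberField L] {A : ℤ} {b c d : ℕ}
  (F : CyclicQuarticFrame L A b c d)

theorem sigma_apply (p q r t : ℚ) :
    F.σ (p + q * F.s + r * F.u + t * F.v) = p - q * F.s - t * F.u + r * F.v := by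
  simp only [map_add, map_mul, map_ratCast, F.sigma_s, F.sigma_u, F.sigma_v]
  ring

theorem isIntegral_sigma {x : L} (hx : IsIntegral ℤ x) : IsIntegral ℤ (F.σ x) :=
  hx.map (F.σ.toAlgHom.restrictScalars ℤ)

theorem isIntegral_quadratic_iff (hsq : Squarefree d) (p q : ℚ) :
    IsIntegral ℤ ((p : L) + q * F.s) ↔
      ∃ m n : ℤ, p = m / 2 ∧ q = n / 2 ∧ 4 ∣ m ^ 2 - d * n ^ 2 := by
  constructor
  · intro h
    have h' : IsIntegral ℤ ((p : L) - q * F.s) := by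
      have := F.isIntegral_sigma h
      simpa [F.sigma_s, sub_eq_add_neg] using this
    have hadd : IsIntegral ℤ (((2 * p : ℚ)) : L) := by
      rw [show ((2 * p : ℚ) : L) = (p + q * F.s) + (p - q * F.s) by push_cast; ring]
      exact h.add h'
    have hmul : IsIntegral ℤ (((p ^ 2 - d * q ^ 2 : ℚ)) : L) := by
      rw [show ((p ^ 2 - d * q ^ 2 : ℚ) : L) = (p + q * F.s) * (p - q * F.s) by
        push_cast
        linear_combination (q : L) ^ 2 * F.s_sq]
      exact h.mul h'
    obtain ⟨m, hm⟩ := isIntegral_ratCast_iff.1 hadd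
    obtain ⟨k, hk⟩ := isIntegral_ratCast_iff.1 hmul
    obtain ⟨n, hn⟩ := exists_int_of_squarefree_mul_sq (D := (d : ℤ)) (Int.squarefree_natCast.2 hsq)
      (q := 2 * q) (n := m ^ 2 - 4 * k) (by
        push_cast
        rw [← hm, ← hk]; ring)
    refine ⟨m, n, by linarith, by linarith, k, ?_⟩
    have : (m : ℚ) ^ 2 - d * n ^ 2 = 4 * k := by
      rw [← hm, ← hn, ← hk]; ring
    exact_mod_cast this
  · rintro ⟨m, n, rfl, rfl, k, hk⟩
    refine isIntegral_of_sq_eq (α := (m : L)) (β := ((-k : ℤ) : L)) ?_ ?_ ?_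
    · exact (algebraMap ℤ L).isIntegralElem_map (x := m)
    · exact (algebraMap ℤ L).isIntegralElem_map (x := -k)
    · have hk' : (m : L) ^ 2 - d * n ^ 2 = 4 * k := by exact_mod_cast congrArg (Int.cast : ℤ → L) hk
      push_cast
      linear_combination (n : L) ^ 2 / 4 * F.s_sq - hk' / 4

theorem sq_add_mul_v (hd : d = b ^ 2 + c ^ 2) (hc : c ≠ 0) (r t : ℚ) :
    ((r : L) * F.u + t * F.v) ^ 2 = ((A * d * (r ^ 2 + t ^ 2) : ℚ) : L) +
      ((A * (b * (r ^ 2 - t ^ 2) + 2 * c * r * t) : ℚ) : L) * F.s := by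
  push_cast
  linear_combination (r : L) ^ 2 * F.u_sq + (t : L) ^ 2 * F.v_sq + 2 * r * t * F.u_mul_v hd hc

/-- An element is integral exactly when its trace and norm to `ℚ(s)` are. Here `(m + n s)/2` is the
trace and `(k + l s)/2` the norm. -/
theorem isIntegral_iff (hd : d = b ^ 2 + c ^ 2) (hc : c ≠ 0) (hsq : Squarefree d) (p q r t : ℚ) :
    IsIntegral ℤ ((p : L) + q * F.s + r * F.u + t * F.v) ↔
      ∃ m n k l : ℤ, p = m / 4 ∧ q = n / 4 ∧ 4 ∣ m ^ 2 - d * n ^ 2 ∧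
        (m : ℚ) ^ 2 + d * n ^ 2 - 16 * A * d * (r ^ 2 + t ^ 2) = 8 * k ∧
        (2 : ℚ) * m * n - 16 * A * (b * (r ^ 2 - t ^ 2) + 2 * c * r * t) = 8 * l ∧
        4 ∣ k ^ 2 - d * l ^ 2 := by
  have hnorm : ((p : L) + q * F.s) ^ 2 - (r * F.u + t * F.v) ^ 2 =
      ((p ^ 2 + d * q ^ 2 - A * d * (r ^ 2 + t ^ 2) : ℚ) : L) +
      ((2 * p * q - A * (b * (r ^ 2 - t ^ 2) + 2 * c * r * t) : ℚ) : L) * F.s := by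
    rw [F.sq_add_mul_v hd hc]
    push_cast
    linear_combination (q : L) ^ 2 * F.s_sq
  constructor
  · intro h
    have h' : IsIntegral ℤ ((p : L) + q * F.s - r * F.u - t * F.v) := by
      have := F.isIntegral_sigma (F.isIntegral_sigma h)
      rw [F.sigma_apply] at this
      have e : F.σ ((p : L) - q * F.s - t * F.u + r * F.v) =
          p + q * F.s - r * F.u - t * F.v := by
        simp only [map_add, map_sub, map_mul, map_ratCast, F.sigma_s, F.sigma_u, F.sigma_v]
        ring
      rwa [e] at this
    have hadd : IsIntegral ℤ (((2 * p : ℚ) : L) + ((2 * q : ℚ) : L) * F.s) := by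
      rw [show ((2 * p : ℚ) : L) + ((2 * q : ℚ) : L) * F.s = (p + q * F.s + r * F.u + t * F.v) +
        (p + q * F.s - r * F.u - t * F.v) by push_cast; ring]
      exact h.add h'
    have hmul := h.mul h'
    rw [show ((p : L) + q * F.s + r * F.u + t * F.v) * (p + q * F.s - r * F.u - t * F.v) =
      (p + q * F.s) ^ 2 - (r * F.u + t * F.v) ^ 2 by ring, hnorm] at hmul
    obtain ⟨m, n, hm, hn, hmn⟩ := (F.isIntegral_quadratic_iff hsq _ _).1 hadd
    obtain ⟨k, l, hk, hl, hkl⟩ := (F.isIntegral_quadratic_iff hsq _ _).1 hmul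
    have hp : p = m / 4 := by linarith
    have hq : q = n / 4 := by linarith
    refine ⟨m, n, k, l, hp, hq, hmn, ?_, ?_, hkl⟩
    · rw [hp, hq] at hk
      linear_combination 16 * hk
    · rw [hp, hq] at hl
      linear_combination 16 * hl
  · rintro ⟨m, n, k, l, rfl, rfl, hmn, hk, hl, hkl⟩
    have hadd : IsIntegral ℤ (((2 * (m / 4) : ℚ) : L) + ((2 * (n / 4) : ℚ) : L) * F.s) :=
      (F.isIntegral_quadratic_iff hsq _ _).2 ⟨m, n, by ring, by ring, hmn⟩
    have hmul : IsIntegral ℤ ((((m / 4 : ℚ) : L) + ((n / 4 : ℚ) : L) * F.s) ^ 2 -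
        (r * F.u + t * F.v) ^ 2) := by
      rw [hnorm]
      refine (F.isIntegral_quadratic_iff hsq _ _).2 ⟨k, l, ?_, ?_, hkl⟩
      · linear_combination hk / 16
      · linear_combination hl / 16
    refine isIntegral_of_sq_eq hadd hmul.neg ?_
    push_cast
    ring

/-- `r u + t v` is a component of an algebraic integer. -/
def IsComponent (r t : ℚ) : Prop :=
  ∃ p q : ℚ, IsIntegral ℤ ((p : L) + q * F.s + r * F.u + t * F.v)

variable {F}

theorem IsComponent.add {r t r' t' : ℚ} (h : F.IsComponent r t) (h' : F.IsComponent r' t') :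
    F.IsComponent (r + r') (t + t') := by
  obtain ⟨p, q, h⟩ := h
  obtain ⟨p', q', h'⟩ := h'
  refine ⟨p + p', q + q', ?_⟩
  have := h.add h'
  rwa [show (p : L) + q * F.s + r * F.u + t * F.v + (p' + q' * F.s + r' * F.u + t' * F.v) =
    ((p + p' : ℚ) : L) + ((q + q' : ℚ) : L) * F.s + ((r + r' : ℚ) : L) * F.u +
      ((t + t' : ℚ) : L) * F.v by push_cast; ring] at this

theorem IsComponent.rotate {r t : ℚ} (h : F.IsComponent r t) : F.IsComponent (-t) r := by
  obtain ⟨p, q, h⟩ := h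
  refine ⟨p, -q, ?_⟩
  have := F.isIntegral_sigma h
  rw [F.sigma_apply] at this
  rwa [show (p : L) - q * F.s - t * F.u + r * F.v =
    (p : L) + ((-q : ℚ) : L) * F.s + ((-t : ℚ) : L) * F.u + r * F.v by push_cast; ring] at this

/-- Subtracting the `σ²`-conjugate from an integer leaves `2(ru + tv)`, whose square must be
integral in `ℚ(s)`. -/
theorem IsComponent.exists_two_mul (hd : d = b ^ 2 + c ^ 2) (hc : c ≠ 0) (hsq : Squarefree d)
    {r t : ℚ} (h : F.IsComponent r t) : ∃ k l : ℤ,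
    8 * A * d * (r ^ 2 + t ^ 2) = k ∧
    8 * A * (b * (r ^ 2 - t ^ 2) + 2 * c * r * t) = l ∧ 4 ∣ k ^ 2 - d * l ^ 2 := by
  obtain ⟨p, q, h⟩ := h
  have h' := h.sub (F.isIntegral_sigma (F.isIntegral_sigma h))
  have e : (p : L) + q * F.s + r * F.u + t * F.v - F.σ (F.σ (p + q * F.s + r * F.u + t * F.v)) =
      ((0 : ℚ) : L) + ((0 : ℚ) : L) * F.s + ((2 * r : ℚ) : L) * F.u + ((2 * t : ℚ) : L) * F.v := by
    simp only [map_add, map_mul, map_ratCast, F.sigma_s, F.sigma_u, F.sigma_v, map_neg]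
    push_cast
    ring
  rw [e, F.isIntegral_iff hd hc hsq] at h'
  obtain ⟨m, n, k, l, hm, hn, -, hk, hl, hkl⟩ := h'
  have hm0 : (m : ℚ) = 0 := by linarith
  have hn0 : (n : ℚ) = 0 := by linarith
  rw [hm0, hn0] at hk hl
  refine ⟨-k, -l, ?_, ?_, by simpa using hkl⟩
  · push_cast; linear_combination -hk / 8
  · push_cast; linear_combination -hl / 8

end CyclicQuarticFrame

/-! ### The lattice of components -/

/-- A `ℤ[i]`-module between `(2/N)ℤ[i]` and `(1/N)ℤ[i]` is one of these two or `((1 + i)/N)ℤ[i]`.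
The hypothesis `h11` excludes the last, the only one not a rational multiple of `ℤ[i]`. -/
theorem exists_eq_int_multiples_of_rotate_invariant {P : ℚ → ℚ → Prop}
    (hadd : ∀ r t r' t', P r t → P r' t' → P (r + r') (t + t'))
    (hrot : ∀ r t, P r t → P (-t) r) {N : ℚ} (hN : N ≠ 0)
    (hint : ∀ r t, P r t → ∃ m n : ℤ, N * r = m ∧ N * t = n) (h2 : P (2 / N) 0)
    (h11 : P (1 / N) (1 / N) → P (1 / N) 0) :
    ∃ μ : ℚ, μ ≠ 0 ∧ ∀ r t, P r t ↔ ∃ m n : ℤ, r = μ * m ∧ t = μ * n := by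
  have hneg : ∀ r t, P r t → P (-r) (-t) := fun r t h => hrot _ _ (hrot _ _ h)
  have hzero : ∀ r t, P r t → P 0 0 := fun r t h => by
    simpa using hadd _ _ _ _ h (hneg _ _ h)
  have hmul : ∀ r t, P r t → ∀ m : ℤ, P (m * r) (m * t) := by
    intro r t h m
    induction m using Int.induction_on with
    | zero => simpa using hzero _ _ h
    | succ i hi =>
      convert hadd _ _ _ _ hi h using 1 <;> push_cast <;> ring
    | pred i hi =>
      convert hadd _ _ _ _ hi (hneg _ _ h) using 1 <;> push_cast <;> ring
  have hcomb : ∀ r, P r 0 → ∀ m n : ℤ, P (r * m) (r * n) := by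
    intro r h m n
    have h' := hrot _ _ h
    convert hadd _ _ _ _ (hmul _ _ h m) (hmul _ _ h' n) using 1 <;> ring
  by_cases h1 : P (1 / N) 0
  · refine ⟨1 / N, one_div_ne_zero hN, fun r t => ⟨fun h => ?_, ?_⟩⟩
    · obtain ⟨m, n, hm, hn⟩ := hint r t h
      refine ⟨m, n, ?_, ?_⟩
      · rw [← hm]; field_simp
      · rw [← hn]; field_simp
    · rintro ⟨m, n, rfl, rfl⟩
      exact hcomb _ h1 m n
  · refine ⟨2 / N, div_ne_zero two_ne_zero hN, fun r t => ⟨fun h => ?_, ?_⟩⟩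
    · obtain ⟨m, n, hm, hn⟩ := hint r t h
      have hr : r = m / N := by rw [← hm]; field_simp
      have ht : t = n / N := by rw [← hn]; field_simp
      rcases Int.even_or_odd' m with ⟨i, hi | hi⟩ <;> rcases Int.even_or_odd' n with ⟨j, hj | hj⟩
      · refine ⟨i, j, ?_, ?_⟩
        · rw [hr, hi]; push_cast; ring
        · rw [ht, hj]; push_cast; ring
      all_goals
        exfalso
        have hs := hadd _ _ _ _ h (hcomb _ h2 (-i) (-j))
      · apply h1
        have := hrot _ _ (hrot _ _ (hrot _ _ hs))
        convert this using 1
        · rw [ht, hj]; push_cast; ring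
        · rw [hr, hi]; push_cast; ring
      · apply h1
        convert hs using 1
        · rw [hr, hi]; push_cast; ring
        · rw [ht, hj]; push_cast; ring
      · apply h1
        apply h11
        convert hs using 1
        · rw [hr, hi]; push_cast; ring
        · rw [ht, hj]; push_cast; ring
    · rintro ⟨m, n, rfl, rfl⟩
      exact hcomb _ h2 m n

namespace CyclicQuarticFrame

variable {L : Type*} [Field L] [NumberField L] {a : ℤ} {b c d : ℕ}

theorem exists_component_lattice_of_odd (F : CyclicQuarticFrame L a b c d)
    (hd : d = b ^ 2 + c ^ 2) (hc : c ≠ 0) (hsq : Squarefree d) (ha : Odd a)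
    (had : Squarefree (a * (d : ℤ))) (hb : Odd b) :
    ∃ μ : ℚ, μ ≠ 0 ∧ ∀ r t, F.IsComponent r t ↔ ∃ m n : ℤ, r = μ * m ∧ t = μ * n := by
  have hdZ : (d : ℤ) = (b : ℤ) ^ 2 + (c : ℤ) ^ 2 := by exact_mod_cast hd
  have hbZ : ∃ β : ℤ, (b : ℤ) = 2 * β + 1 := by
    obtain ⟨β, hβ⟩ := hb
    exact ⟨β, by exact_mod_cast hβ⟩
  obtain ⟨β, hβ⟩ := hbZ
  obtain ⟨α, hα⟩ := ha
  have hcd : (∃ γ δ : ℤ, (c : ℤ) = 2 * γ ∧ (d : ℤ) = 4 * δ + 1) ∨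
      (∃ γ δ : ℤ, (c : ℤ) = 2 * γ + 1 ∧ (d : ℤ) = 4 * δ + 2) := by
    rcases Int.even_or_odd' (c : ℤ) with ⟨γ, hγ | hγ⟩
    · exact Or.inl ⟨γ, β ^ 2 + β + γ ^ 2, hγ, by rw [hdZ, hβ, hγ]; ring⟩
    · exact Or.inr ⟨γ, β ^ 2 + β + γ ^ 2 + γ, hγ, by rw [hdZ, hβ, hγ]; ring⟩
  refine exists_eq_int_multiples_of_rotate_invariant (P := F.IsComponent) (N := 2)
    (fun r t r' t' h h' => h.add h') (fun r t h => h.rotate) two_ne_zero ?_ ?_ ?_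
  · intro r t h
    obtain ⟨k, l, hk, hl, e, hkl⟩ := h.exists_two_mul hd hc hsq
    obtain ⟨x, y, hx, hy⟩ := exists_int_of_norm_forms (a := a) (b := b) (c := c) (d := d)
      (R := 2 * (2 * r)) (T := 2 * (2 * t)) (m := 2 * k) (n := 2 * l) ⟨α, hα⟩ had hdZ
      (by push_cast; linear_combination 2 * hk) (by push_cast; linear_combination 2 * hl)
    have h1 : a * d * (x ^ 2 + y ^ 2) = 2 * k := by
      have : (a : ℚ) * d * (x ^ 2 + y ^ 2) = 2 * k := by
        rw [← hx, ← hy, ← hk]; ring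
      exact_mod_cast this
    have h2 : a * (b * (x ^ 2 - y ^ 2) + 2 * c * x * y) = 2 * l := by
      have : (a : ℚ) * (b * (x ^ 2 - y ^ 2) + 2 * c * x * y) = 2 * l := by
        rw [← hx, ← hy, ← hl]; ring
      exact_mod_cast this
    rcases Int.even_or_odd' x with ⟨i, hi | hi⟩ <;> rcases Int.even_or_odd' y with ⟨j, hj | hj⟩
    · refine ⟨i, j, ?_, ?_⟩
      · rw [hi] at hx; push_cast at hx; linarith
      · rw [hj] at hy; push_cast at hy; linarith
    · exfalso
      rw [hi, hj, hα, hβ] at h2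
      ring_nf at h2
      omega
    · exfalso
      rw [hi, hj, hα, hβ] at h2
      ring_nf at h2
      omega
    · exfalso
      have hl' : l = a * (2 * b * (i ^ 2 + i - j ^ 2 - j) + c * x * y) := by
        rw [hi, hj] at h2 ⊢
        apply mul_left_cancel₀ (two_ne_zero (α := ℤ))
        linear_combination -h2
      have hk' : k = a * d * (2 * (i ^ 2 + i + j ^ 2 + j) + 1) := by
        rw [hi, hj] at h1
        apply mul_left_cancel₀ (two_ne_zero (α := ℤ))
        linear_combination -h1
      -- With `x` and `y` odd, `k` and `l` have opposite parity, which prevents 4 from dividing `k²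
      -- - d l²`.
      rcases hcd with ⟨γ, δ, hγ, hδ⟩ | ⟨γ, δ, hγ, hδ⟩
      · have ek : Odd k := by
          rw [hk', hα, hδ]
          exact ((odd_two_mul_add_one _).mul (by exact ⟨2 * δ, by ring⟩)).mul (odd_two_mul_add_one _)
        have el : Even l := by
          rw [hl', hγ]
          exact ⟨a * (b * (i ^ 2 + i - j ^ 2 - j) + γ * x * y), by ring⟩
        obtain ⟨k₁, rfl⟩ := ek
        obtain ⟨l₁, rfl⟩ := el
        ring_nf at hkl
        omega
      · have ek : Even k := by
          rw [hk', hδ]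
          exact ⟨a * (2 * δ + 1) * (2 * (i ^ 2 + i + j ^ 2 + j) + 1), by ring⟩
        have el : Odd l := by
          rw [hl']
          refine Odd.mul ⟨α, hα⟩ (Even.add_odd ⟨b * (i ^ 2 + i - j ^ 2 - j), by ring⟩ ?_)
          exact (Odd.mul ⟨γ, hγ⟩ ⟨i, hi⟩).mul ⟨j, hj⟩
        obtain ⟨k₁, rfl⟩ := ek
        obtain ⟨l₁, rfl⟩ := el
        rw [hδ] at hkl
        ring_nf at hkl
        omega
  · refine ⟨0, 0, (F.isIntegral_iff hd hc hsq _ _ _ _).2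
      ⟨0, 0, -2 * a * d, -2 * a * b, by simp, by simp, by simp, ?_, ?_, a ^ 2 * d * c ^ 2, ?_⟩⟩
    · push_cast; ring
    · push_cast; ring
    · rw [hdZ]; ring
  -- The mixed lattice is excluded because `(u + v)/2` is never a component: all parities contradict
  -- the trace and norm conditions.
  · intro h
    exfalso
    obtain ⟨p, q, h⟩ := h
    obtain ⟨m, n, k, l, -, -, ⟨e, he⟩, hk, hl, ⟨f, hf⟩⟩ := (F.isIntegral_iff hd hc hsq _ _ _ _).1 h
    have hk' : m ^ 2 + d * n ^ 2 - 8 * a * d = 8 * k := by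
      have : (m : ℚ) ^ 2 + d * n ^ 2 - 8 * a * d = 8 * k := by rw [← hk]; ring
      exact_mod_cast this
    have hl' : m * n - 4 * a * c = 4 * l := by
      have : (m : ℚ) * n - 4 * a * c = 4 * l := by linear_combination hl / 2
      exact_mod_cast this
    rcases hcd with ⟨γ, δ, hγ, hδ⟩ | ⟨γ, δ, hγ, hδ⟩
    · rcases Int.even_or_odd' m with ⟨i, hi | hi⟩ <;> rcases Int.even_or_odd' n with ⟨j, hj | hj⟩
      · have hk2 : i ^ 2 + d * j ^ 2 = 2 * k + 2 * a * d := by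
          rw [hi, hj] at hk'
          apply mul_left_cancel₀ (four_ne_zero (α := ℤ))
          linear_combination hk'
        have hl2 : i * j = l + a * c := by
          rw [hi, hj] at hl'
          apply mul_left_cancel₀ (four_ne_zero (α := ℤ))
          linear_combination hl'
        rw [hδ, hα] at hk2
        rw [hγ] at hl2
        rw [hδ] at hf
        rcases Int.even_or_odd' i with ⟨i₁, hi₁ | hi₁⟩ <;>
        rcases Int.even_or_odd' j with ⟨j₁, hj₁ | hj₁⟩ <;>
        rcases Int.even_or_odd' k with ⟨k₁, hk₁ | hk₁⟩ <;>
        rcases Int.even_or_odd' l with ⟨l₁, hl₁ | hl₁⟩ <;>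
        rw [hi₁, hj₁, hk₁] at hk2 <;> rw [hi₁, hj₁, hl₁] at hl2 <;> rw [hk₁, hl₁] at hf <;>
        ring_nf at hk2 hl2 hf <;> omega
      all_goals
        rw [hi, hj, hδ] at hk' he
        ring_nf at hk' he
        omega
    · rcases Int.even_or_odd' m with ⟨i, hi | hi⟩ <;> rcases Int.even_or_odd' n with ⟨j, hj | hj⟩
      · have hk2 : i ^ 2 + d * j ^ 2 = 2 * k + 2 * a * d := by
          rw [hi, hj] at hk'
          apply mul_left_cancel₀ (four_ne_zero (α := ℤ))
          linear_combination hk'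
        have hl2 : i * j = l + a * c := by
          rw [hi, hj] at hl'
          apply mul_left_cancel₀ (four_ne_zero (α := ℤ))
          linear_combination hl'
        rw [hδ, hα] at hk2
        rw [hγ, hα] at hl2
        rw [hδ] at hf
        rcases Int.even_or_odd' i with ⟨i₁, hi₁ | hi₁⟩ <;>
        rcases Int.even_or_odd' k with ⟨k₁, hk₁ | hk₁⟩ <;>
        rcases Int.even_or_odd' l with ⟨l₁, hl₁ | hl₁⟩ <;>
        rw [hi₁, hk₁] at hk2 <;> rw [hi₁, hl₁] at hl2 <;> rw [hk₁, hl₁] at hf <;>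
        ring_nf at hk2 hl2 hf <;> omega
      all_goals
        rw [hi, hj, hδ] at he
        ring_nf at he
        omega

theorem exists_component_lattice_of_two_mul_odd (F : CyclicQuarticFrame L (2 * a) b c d)
    (hd : d = b ^ 2 + c ^ 2) (hc : c ≠ 0) (hsq : Squarefree d) (ha : Odd a)
    (had : Squarefree (a * (d : ℤ))) (hb : Odd b) (hce : Even c) :
    ∃ μ : ℚ, μ ≠ 0 ∧ ∀ r t, F.IsComponent r t ↔ ∃ m n : ℤ, r = μ * m ∧ t = μ * n := by
  have hdZ : (d : ℤ) = (b : ℤ) ^ 2 + (c : ℤ) ^ 2 := by exact_mod_cast hd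
  obtain ⟨β, hβ⟩ : ∃ β : ℤ, (b : ℤ) = 2 * β + 1 := by
    obtain ⟨β, hβ⟩ := hb
    exact ⟨β, by exact_mod_cast hβ⟩
  obtain ⟨γ, hγ⟩ : ∃ γ : ℤ, (c : ℤ) = 2 * γ := by
    obtain ⟨γ, hγ⟩ := hce
    exact ⟨γ, by push_cast [hγ]; ring⟩
  have hδ : (d : ℤ) = 4 * (β ^ 2 + β + γ ^ 2) + 1 := by rw [hdZ, hβ, hγ]; ring
  generalize β ^ 2 + β + γ ^ 2 = δ at hδ
  refine exists_eq_int_multiples_of_rotate_invariant (P := F.IsComponent) (N := 4)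
    (fun r t r' t' h h' => h.add h') (fun r t h => h.rotate) four_ne_zero ?_ ?_ ?_
  · intro r t h
    obtain ⟨k, l, hk, hl, -⟩ := h.exists_two_mul hd hc hsq
    obtain ⟨x, y, hx, hy⟩ := exists_int_of_norm_forms (a := a) (b := b) (c := c) (d := d)
      (R := 4 * r) (T := 4 * t) (m := k) (n := l) ha had hdZ
      (by rw [← hk]; push_cast; ring) (by rw [← hl]; push_cast; ring)
    exact ⟨x, y, hx, hy⟩
  · refine ⟨0, 0, (F.isIntegral_iff hd hc hsq _ _ _ _).2
      ⟨0, 0, -a * d, -a * b, by simp, by simp, by simp, ?_, ?_, a ^ 2 * d * γ ^ 2, ?_⟩⟩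
    · push_cast; ring
    · push_cast; ring
    · have hcγ : (d : ℤ) - b ^ 2 = 4 * γ ^ 2 := by rw [hdZ, hγ]; ring
      linear_combination a ^ 2 * d * hcγ
  · rintro ⟨p, q, h⟩
    obtain ⟨m, n, k, l, -, -, ⟨e, he⟩, hk, hl, ⟨f, hf⟩⟩ := (F.isIntegral_iff hd hc hsq _ _ _ _).1 h
    have hk' : m ^ 2 + d * n ^ 2 - 4 * a * d = 8 * k := by
      have : (m : ℚ) ^ 2 + d * n ^ 2 - 4 * a * d = 8 * k := by
        rw [← hk]; push_cast; ring
      exact_mod_cast this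
    have hl' : m * n - 2 * a * c = 4 * l := by
      have : (m : ℚ) * n - 2 * a * c = 4 * l := by
        push_cast at hl
        linear_combination hl / 2
      exact_mod_cast this
    -- If `(u + v)/4` is a component, the trace and norm conditions force this congruence, which in
    -- turn makes `u/4` a component.
    have hac : 4 ∣ a - 1 - c := by
      obtain ⟨α, hα⟩ := ha
      rw [hδ] at he hf
      rcases Int.even_or_odd' m with ⟨i, hi | hi⟩ <;> rcases Int.even_or_odd' n with ⟨j, hj | hj⟩
      · have hk2 : i ^ 2 + d * j ^ 2 = 2 * k + a * d := by
          rw [hi, hj] at hk'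
          apply mul_left_cancel₀ (four_ne_zero (α := ℤ))
          linear_combination hk'
        have hl2 : i * j = l + a * γ := by
          rw [hi, hj, hγ] at hl'
          apply mul_left_cancel₀ (four_ne_zero (α := ℤ))
          linear_combination hl'
        rw [hδ, hα] at hk2
        rw [hα] at hl2
        rw [hγ, hα]
        rcases Int.even_or_odd' i with ⟨i₁, hi₁ | hi₁⟩ <;>
        rcases Int.even_or_odd' j with ⟨j₁, hj₁ | hj₁⟩ <;>
        rcases Int.even_or_odd' k with ⟨k₁, hk₁ | hk₁⟩ <;>
        rcases Int.even_or_odd' l with ⟨l₁, hl₁ | hl₁⟩ <;>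
        rw [hi₁, hj₁, hk₁] at hk2 <;> rw [hi₁, hj₁, hl₁] at hl2 <;> rw [hk₁, hl₁] at hf <;>
        ring_nf at hk2 hl2 hf <;> omega
      all_goals
        exfalso
        rw [hi, hj, hγ] at hl'
        rw [hi, hj] at he
        ring_nf at hl' he
        omega
    obtain ⟨α, hα⟩ := hac
    -- The sign is chosen so that `ε b ≡ 1 + c ≡ a` modulo 4, hence `a ε b ≡ 1`. The integer with
    -- component `u/4` will be `(1 + ε s + u)/4`, of norm `((2X + lam) + ε lam s)/2`.
    obtain ⟨ε, g, hε, hb0⟩ : ∃ ε g : ℤ, ε ^ 2 = 1 ∧ ε * b = 1 + 2 * γ + 4 * g := by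
      rcases Int.even_or_odd' β with ⟨β₁, hβ₁ | hβ₁⟩ <;>
      rcases Int.even_or_odd' γ with ⟨γ₁, hγ₁ | hγ₁⟩
      · exact ⟨1, β₁ - γ₁, by norm_num, by rw [hβ, hβ₁, hγ₁]; ring⟩
      · exact ⟨-1, -β₁ - γ₁ - 1, by norm_num, by rw [hβ, hβ₁, hγ₁]; ring⟩
      · exact ⟨-1, -β₁ - γ₁ - 1, by norm_num, by rw [hβ, hβ₁, hγ₁]; ring⟩
      · exact ⟨1, β₁ - γ₁, by norm_num, by rw [hβ, hβ₁, hγ₁]; ring⟩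
    have hα' : a = 1 + 2 * γ + 4 * α := by rw [hγ] at hα; linear_combination hα
    have hdε : (d : ℤ) = (1 + 2 * γ + 4 * g) ^ 2 + 4 * γ ^ 2 := by
      rw [hdZ, hγ, ← hb0]; linear_combination -(b : ℤ) ^ 2 * hε
    set w := 1 + 2 * γ with hw
    set X := w * g + g ^ 2 - w * γ ^ 2 - w ^ 2 * g - 2 * w * g ^ 2 -
      α * (γ + 4 * γ ^ 2 + 4 * w * g - 2 * g + 8 * g ^ 2) with hX
    set lam := -(γ + γ ^ 2 + w * (α + g) + 4 * α * g) with hlam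
    have h1 : 1 - a * (ε * b) = 4 * lam := by rw [hb0, hα', hlam, hw]; ring
    have h2 : 1 + d - 2 * a * d = 8 * (2 * X + lam) := by
      rw [hdε, hα', hX, hlam, hw]; ring
    refine ⟨1 / 4, ε / 4, (F.isIntegral_iff hd hc hsq _ _ _ _).2
      ⟨1, ε, 2 * X + lam, ε * lam, by simp, by simp, ⟨-δ, ?_⟩, ?_, ?_,
        X ^ 2 + X * lam - δ * lam ^ 2, ?_⟩⟩
    · rw [hε, hδ]; ring
    · have h2' : (1 : ℚ) + d - 2 * a * d = 8 * (2 * X + lam) := by exact_mod_cast h2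
      have hε' : (ε : ℚ) ^ 2 = 1 := by exact_mod_cast hε
      push_cast
      linear_combination h2' + d * hε'
    · have h1' : (1 : ℚ) - a * (ε * b) = 4 * lam := by exact_mod_cast h1
      have hε' : (ε : ℚ) ^ 2 = 1 := by exact_mod_cast hε
      push_cast
      linear_combination 2 * ε * h1' + 2 * a * b * hε'
    · rw [mul_pow, hε, hδ]; ring

end CyclicQuarticFrame

/-! ### Freeness over the associated order -/

namespace HopfGaloisStructure

variable {L H : Type*} [Field L] [NumberField L] [Ring H] [HopfAlgebra ℚ H]

theorem exists_mul_mem_associatedOrder (S : HopfGaloisStructure ℚ L H) (h : H) :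
    ∃ n : ℤ, n ≠ 0 ∧ (n : H) * h ∈ S.associatedOrder := by
  classical
  obtain ⟨G, hG⟩ := Module.Finite.fg_top (R := ℤ) (M := 𝓞 L)
  obtain ⟨n, hn0, hn⟩ := exists_integral_multiples ℤ ℚ
    (G.image fun x : 𝓞 L => S.act h (x : L))
  refine ⟨n, hn0, fun x => ?_⟩
  have hx : x ∈ Submodule.span ℤ (G : Set (𝓞 L)) := by rw [hG]; trivial
  have hact : ∀ x : 𝓞 L, S.act ((n : H) * h) x = n • S.act h x := by
    intro x
    rw [map_mul, map_intCast]
    simp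
  induction hx using Submodule.span_induction with
  | mem y hy =>
    rw [hact]
    exact hn _ (Finset.mem_image_of_mem _ hy)
  | zero => simpa using isIntegral_zero
  | add y z _ _ hy hz =>
    have := hy.add hz
    rwa [← map_add] at this
  | smul m y _ hy =>
    have := hy.smul m
    rwa [← map_zsmul] at this

/-- The associated order spans `H` over `ℚ`, and `H` and `L` have equal dimension. One basis vector
therefore generates `L` over `H`, and a second would be dependent on it after clearing denominators.
-/
theorem exists_generator_of_free [IsGalois ℚ L] (S : HopfGaloisStructure ℚ L H)
    (hfree : Module.Free S.associatedOrder (𝓞 L)) :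
    ∃ α : 𝓞 L, ∀ y : 𝓞 L, ∃ h : S.associatedOrder, S.act h (α : L) = y := by
  have := S.finiteDimensional
  have hHinj : ∀ (n : ℤ) (h : H), n ≠ 0 → (n : H) * h = 0 → h = 0 := by
    intro n h hn e
    have e' : (n : ℚ) • h = 0 := by
      rw [Algebra.smul_def, ← e]; simp
    exact (smul_eq_zero.1 e').resolve_left (Int.cast_ne_zero.2 hn)
  let B := Module.Free.chooseBasis S.associatedOrder (𝓞 L)
  have hsmul : ∀ (h : S.associatedOrder) (x : 𝓞 L), ((h • x : 𝓞 L) : L) = S.act h x :=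
    fun _ _ => rfl
  have hne : Nonempty (Module.Free.ChooseBasisIndex S.associatedOrder (𝓞 L)) := B.index_nonempty
  obtain ⟨i⟩ := hne
  let Φ : H →ₗ[ℚ] L := S.act.toLinearMap.flip (B i : L)
  have hΦ : ∀ h, Φ h = S.act h (B i : L) := fun h => rfl
  have hinj : Function.Injective Φ := by
    rw [← LinearMap.ker_eq_bot, LinearMap.ker_eq_bot']
    intro h hh
    obtain ⟨n, hn, hmem⟩ := S.exists_mul_mem_associatedOrder h
    have h0 : (⟨(n : H) * h, hmem⟩ : S.associatedOrder) • B i = 0 := by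
      apply NumberField.RingOfIntegers.ext
      rw [hsmul]
      simp only [map_mul, Module.End.mul_apply]
      rw [← hΦ, hh]
      simp
    have h1 : (⟨(n : H) * h, hmem⟩ : S.associatedOrder) = 0 := by
      have := congrArg (fun y => B.repr y i) h0
      simpa using this
    exact hHinj n h hn (congrArg Subtype.val h1)
  have hsurj : Function.Surjective Φ :=
    (LinearMap.injective_iff_surjective_of_finrank_eq_finrank S.finrank_eq).1 hinj
  have huniq : ∀ j, j = i := by
    intro j
    by_contra hj
    obtain ⟨h, hh⟩ := hsurj (B j : L)
    obtain ⟨n, hn, hmem⟩ := S.exists_mul_mem_associatedOrder h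
    have h0 : (⟨(n : H) * h, hmem⟩ : S.associatedOrder) • B i = (n : S.associatedOrder) • B j := by
      apply NumberField.RingOfIntegers.ext
      rw [hsmul, hsmul]
      simp only [map_mul, Module.End.mul_apply]
      rw [← hΦ, hh]
      rfl
    have h1 : (n : S.associatedOrder) = 0 := by
      have := congrArg (fun y => B.repr y j) h0
      simpa [Finsupp.single_apply, hj, Ne.symm hj] using this.symm
    have h2 : (n : H) * 1 = 0 := by
      have := congrArg (Subtype.val) h1
      simpa using this
    have h3 : (1 : H) = 0 := hHinj n 1 hn h2
    have h4 : S.act (1 : H) (1 : L) = 1 := by rw [map_one S.act]; rfl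
    rw [h3, map_zero] at h4
    exact zero_ne_one h4
  refine ⟨B i, fun y => ⟨B.repr y i, ?_⟩⟩
  rw [← hsmul]
  congr 1
  have : Unique (Module.Free.ChooseBasisIndex S.associatedOrder (𝓞 L)) := ⟨⟨i⟩, huniq⟩
  have hi : (default : Module.Free.ChooseBasisIndex S.associatedOrder (𝓞 L)) = i := huniq _
  have := B.linearCombination_repr y
  rw [Finsupp.linearCombination_unique, hi] at this
  exact this

end HopfGaloisStructure

/-! ### Non-classical action on components and the binary form -/

namespace CyclicQuarticFrame

variable {L : Type*} [Field L] [NumberField L] {A : ℤ} {b c d : ℕ}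
  (F : CyclicQuarticFrame L A b c d)

theorem rat_ext (hc : c ≠ 0) {p q r t p' q' r' t' : ℚ}
    (h : (p : L) + q * F.s + r * F.u + t * F.v = p' + q' * F.s + r' * F.u + t' * F.v) :
    p = p' ∧ q = q' ∧ r = r' ∧ t = t' := by
  have h' := congrArg (fun x => F.σ (F.σ x)) h
  simp only [map_add, map_mul, map_ratCast, F.sigma_s, F.sigma_u, F.sigma_v, map_neg] at h'
  obtain ⟨h1, h2⟩ := F.rat_ext_s (p := p) (q := q) (p' := p') (q' := q') (by
    linear_combination (h + h') / 2)
  obtain ⟨h3, h4⟩ := F.rat_ext_v hc (r := r) (t := t) (r' := r') (t' := t') (by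
    linear_combination (h - h') / 2)
  exact ⟨h1, h2, h3, h4⟩

theorem exists_rat_of_sigma_sigma_eq (hc : c ≠ 0) {x : L} (hx : F.σ (F.σ x) = x) :
    ∃ p q : ℚ, x = p + q * F.s := by
  obtain ⟨p, q, r, t, rfl⟩ := F.span x
  simp only [map_add, map_mul, map_ratCast, F.sigma_s, F.sigma_u, F.sigma_v, map_neg] at hx
  obtain ⟨-, -, h3, h4⟩ := F.rat_ext hc (p := p) (q := q) (r := -r) (t := -t) (p' := p) (q' := q)
    (r' := r) (t' := t) (by push_cast; linear_combination hx)
  have hr : r = 0 := by linarith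
  have ht : t = 0 := by linarith
  exact ⟨p, q, by rw [hr, ht]; simp⟩

theorem exists_rat_of_sigma_eq (hc : c ≠ 0) {x : L} (hx : F.σ x = x) : ∃ p : ℚ, x = p := by
  obtain ⟨p, q, rfl⟩ := F.exists_rat_of_sigma_sigma_eq hc (by rw [hx, hx])
  simp only [map_add, map_mul, map_ratCast, F.sigma_s] at hx
  obtain ⟨-, h2⟩ := F.rat_ext_s (p := p) (q := -q) (p' := p) (q' := q) (by
    push_cast; linear_combination hx)
  have hq : q = 0 := by linarith
  exact ⟨p, by rw [hq]; simp⟩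

variable {H : Type*} [Ring H] [HopfAlgebra ℚ H]

/-- On the `u, v` components, an element of a non-classical Hopf algebra acts as `P + Q s σ`. -/
theorem exists_act_components [IsGalois ℚ L] (hc : c ≠ 0) (S : HopfGaloisStructure ℚ L H)
    (hS : ¬ S.IsClassical) (h : H) : ∃ P Q : ℚ, ∀ p q r t : ℚ, ∃ p' q' : ℚ,
      S.act h (p + q * F.s + r * F.u + t * F.v) = p' + q' * F.s +
        ((P * r + Q * (r * c - t * b) : ℚ) : L) * F.u +
        ((P * t - Q * (r * b + t * c) : ℚ) : L) * F.v := by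
  have hσ := F.eq_sigma_pow hc
  have h4 := F.orderOf_sigma
  obtain ⟨e0, e1, e2, e3⟩ := S.coeff_of_not_isClassical hσ h4 hS h
  obtain ⟨k0, hk0⟩ := F.exists_rat_of_sigma_eq hc e0
  obtain ⟨k2, hk2⟩ := F.exists_rat_of_sigma_eq hc e2
  obtain ⟨q0, q1, hq⟩ := F.exists_rat_of_sigma_sigma_eq hc (x := S.coeff F.σ h) (by rw [e1, e3])
  have hq3 : S.coeff (F.σ ^ 3) h = q0 - q1 * F.s := by
    rw [← e1, hq]
    simp only [map_add, map_mul, map_ratCast, F.sigma_s]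
    ring
  refine ⟨k0 - k2, 2 * q1, fun p q r t => ⟨(k0 + k2 + 2 * q0) * p, (k0 + k2 - 2 * q0) * q, ?_⟩⟩
  rw [S.act_apply, sum_galois_of_cyclic_four hσ h4, hk0, hk2, hq, hq3]
  have hp2 : ∀ x, (F.σ ^ 2) x = F.σ (F.σ x) := fun x => rfl
  have hp3 : ∀ x, (F.σ ^ 3) x = F.σ (F.σ (F.σ x)) := fun x => rfl
  have hp1 : ∀ x : L, (1 : L ≃ₐ[ℚ] L) x = x := fun x => rfl
  simp only [hp1, hp2, hp3, map_add, map_mul, map_ratCast, F.sigma_s, F.sigma_u, F.sigma_v, map_neg]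
  push_cast
  linear_combination (2 * q1 * r : L) * F.s_mul_v - (2 * q1 * t : L) * F.s_mul_u

theorem form_represents_unit [IsGalois ℚ L] (hc : c ≠ 0) (hbc : IsCoprime (b : ℤ) (2 * c))
    (hlat : ∃ μ : ℚ, μ ≠ 0 ∧ ∀ r t, F.IsComponent r t ↔ ∃ m n : ℤ, r = μ * m ∧ t = μ * n)
    (S : HopfGaloisStructure ℚ L H) (hS : ¬ S.IsClassical)
    (hfree : Module.Free S.associatedOrder (𝓞 L)) :
    ∃ x y : ℤ, IsUnit (b * x ^ 2 + 2 * c * x * y - b * y ^ 2) := by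
  obtain ⟨μ, hμ, hlat⟩ := hlat
  obtain ⟨α, hα⟩ := S.exists_generator_of_free hfree
  obtain ⟨p, q, r, t, hpq⟩ := F.span (α : L)
  obtain ⟨x, y, rfl, rfl⟩ := (hlat r t).1 ⟨p, q, by rw [← hpq]; exact α.2⟩
  have key : ∀ X Y : ℤ, ∃ P Q : ℤ, P * x + Q * (x * c - y * b) = X ∧
      P * y - Q * (x * b + y * c) = Y := by
    intro X Y
    obtain ⟨p₁, q₁, h₁⟩ := (hlat (μ * X) (μ * Y)).2 ⟨X, Y, rfl, rfl⟩
    obtain ⟨h, hh⟩ := hα ⟨_, h₁⟩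
    obtain ⟨P, Q, hPQ⟩ := F.exists_act_components hc S hS (h : H)
    have hstab : ∀ r t, F.IsComponent r t →
        F.IsComponent (P * r + Q * (r * c - t * b)) (P * t - Q * (r * b + t * c)) := by
      rintro r t ⟨p, q, hi⟩
      obtain ⟨p', q', e⟩ := hPQ p q r t
      refine ⟨p', q', ?_⟩
      rw [← e]
      exact h.2 ⟨_, hi⟩
    -- Stability on both lattice generators makes `P ± Qc` and `Qb` integers. Hence `2cQ` is an
    -- integer too, and Bézout for `b` and `2c` gives integrality of `Q`, then of `P`.
    obtain ⟨m₁, n₁, hm₁, hn₁⟩ := (hlat _ _).1 (hstab _ _ ((hlat μ 0).2 ⟨1, 0, by simp, by simp⟩))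
    obtain ⟨m₂, n₂, hm₂, hn₂⟩ := (hlat _ _).1 (hstab _ _ ((hlat 0 μ).2 ⟨0, 1, by simp, by simp⟩))
    have f1 : P + Q * c = m₁ := mul_left_cancel₀ hμ (by linear_combination hm₁)
    have f2 : -(Q * b) = n₁ := mul_left_cancel₀ hμ (by linear_combination hn₁)
    have f3 : P - Q * c = n₂ := mul_left_cancel₀ hμ (by linear_combination hn₂)
    obtain ⟨i, j, hij⟩ := hbc
    have hij' : (i : ℚ) * b + j * (2 * c) = 1 := by exact_mod_cast hij
    have hQ : Q = ((-i * n₁ + j * (m₁ - n₂) : ℤ) : ℚ) := by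
      push_cast
      rw [← f1, ← f2, ← f3]
      linear_combination -Q * hij'
    have hP : P = ((m₁ - (-i * n₁ + j * (m₁ - n₂)) * c : ℤ) : ℚ) := by
      have : P = m₁ - Q * c := by linear_combination f1
      rw [this, hQ]; push_cast; ring
    generalize -i * n₁ + j * (m₁ - n₂) = Q' at hQ hP
    generalize m₁ - Q' * c = P' at hP
    obtain ⟨p', q', e⟩ := hPQ p q (μ * x) (μ * y)
    rw [← hpq, hh] at e
    change (p₁ : L) + q₁ * F.s + ((μ * X : ℚ) : L) * F.u + ((μ * Y : ℚ) : L) * F.v = _ at e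
    obtain ⟨-, -, g1, g2⟩ := F.rat_ext hc e
    refine ⟨P', Q', ?_, ?_⟩
    · have : (P' : ℚ) * x + Q' * (x * c - y * b) = X := by
        rw [← hP, ← hQ]
        exact mul_left_cancel₀ hμ (by linear_combination -g1)
      exact_mod_cast this
    · have : (P' : ℚ) * y - Q' * (x * b + y * c) = Y := by
        rw [← hP, ← hQ]
        exact mul_left_cancel₀ hμ (by linear_combination -g2)
      exact_mod_cast this
  obtain ⟨P₁, Q₁, h11, h12⟩ := key 1 0
  obtain ⟨P₂, Q₂, h21, h22⟩ := key 0 1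
  -- Multiplicativity of determinants: the solutions for the two unit vectors give an inverse
  -- matrix, so up to sign the form times this determinant is 1.
  refine ⟨x, y, IsUnit.of_mul_eq_one (P₂ * Q₁ - P₁ * Q₂) ?_⟩
  have e : (b * x ^ 2 + 2 * c * x * y - b * y ^ 2) * (P₂ * Q₁ - P₁ * Q₂) =
      (P₁ * x + Q₁ * (x * c - y * b)) * (P₂ * y - Q₂ * (x * b + y * c)) -
      (P₁ * y - Q₁ * (x * b + y * c)) * (P₂ * x + Q₂ * (x * c - y * b)) := by ring
  rw [e, h11, h12, h21, h22]
  norm_num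

end CyclicQuarticFrame

/-! ### The norm equation and the conclusion -/

theorem not_exists_sq_sub_mul_sq_of_jacobiSym {b : ℤ} {d D : ℕ} (hD : D ∣ d)
    (hJ : jacobiSym b D = -1) : ¬ ∃ x y : ℤ, x ^ 2 - (d : ℤ) * y ^ 2 = b := by
  rintro ⟨x, y, h⟩
  have hmod : b % D = x ^ 2 % D := by
    apply Int.emod_emod_of_dvd _ (dvd_refl _) |>.symm.trans
    rw [← h]
    obtain ⟨k, rfl⟩ := hD
    have : x ^ 2 - ((D * k : ℕ) : ℤ) * y ^ 2 = x ^ 2 + D * (-(k * y ^ 2)) := by push_cast; ring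
    rw [this, Int.emod_emod_of_dvd _ (dvd_refl _), Int.add_mul_emod_self_left]
  rw [jacobiSym.mod_left' hmod, jacobiSym.pow_left] at hJ
  nlinarith [sq_nonneg (jacobiSym x D)]

/-- Up to sign, `b` times the form is `(bx + cy)² - dy²` and also `(by - cx)² - dx²`; the two
completions have opposite signs, so both unit values serve. -/
theorem exists_sq_sub_mul_sq_of_isUnit_form {b c d : ℤ} (hd : d = b ^ 2 + c ^ 2)
    (h : ∃ x y : ℤ, IsUnit (b * x ^ 2 + 2 * c * x * y - b * y ^ 2)) :
    ∃ x y : ℤ, x ^ 2 - d * y ^ 2 = b := by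
  obtain ⟨x, y, h⟩ := h
  rcases Int.isUnit_iff.1 h with h | h
  · exact ⟨b * x + c * y, y, by rw [hd]; linear_combination b * h⟩
  · exact ⟨b * y - c * x, x, by rw [hd]; linear_combination -b * h⟩

theorem isCoprime_two_mul_of_squarefree {b c d : ℕ} (hb : Odd b) (hd : d = b ^ 2 + c ^ 2)
    (hsq : Squarefree d) : IsCoprime (b : ℤ) (2 * c) := by
  have hcop : Nat.Coprime b c := by
    refine Nat.isUnit_iff.1 (hsq (Nat.gcd b c) ?_)
    rw [hd, ← pow_two]
    exact dvd_add (pow_dvd_pow_of_dvd (Nat.gcd_dvd_left b c) 2)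
      (pow_dvd_pow_of_dvd (Nat.gcd_dvd_right b c) 2)
  have h2 : Nat.Coprime b 2 := Nat.coprime_two_right.2 hb
  have := Nat.isCoprime_iff_coprime.2 (Nat.Coprime.mul_right h2 hcop)
  exact_mod_cast this

theorem mainTheorem12 {L : Type*} [Field L] [NumberField L]
    (a : ℤ) (b c d e : ℕ)
    (ha_odd : Odd a) (ha_sqf : Squarefree a) (hb : 0 < b) (hc : 0 < c)
    (hd : d = b ^ 2 + c ^ 2) (hd_sqf : Squarefree d) (had : IsCoprime a (d : ℤ))
    (hb_odd : Odd b) (he : e = b ∨ (Even c ∧ e = c))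
    (s z : L) (hs : s ^ 2 = (d : L)) (hz : z ^ 2 = (a : L) * ((d : L) + (e : L) * s))
    (hL : IntermediateField.adjoin ℚ {z} = ⊤)
    (hJ : (Odd d ∧ jacobiSym (b : ℤ) d = -1) ∨ (Even d ∧ jacobiSym (b : ℤ) (d / 2) = -1)) :
    (¬ ∃ x y : ℤ, x ^ 2 - (d : ℤ) * y ^ 2 = (b : ℤ)) ∧
    ∀ {H : Type*} [Ring H] [HopfAlgebra ℚ H] (S : HopfGaloisStructure ℚ L H),
      ¬ S.IsClassical → ¬ Module.Free S.associatedOrder (𝓞 L) := by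
  have hnot : ¬ ∃ x y : ℤ, x ^ 2 - (d : ℤ) * y ^ 2 = (b : ℤ) := by
    rcases hJ with ⟨-, hJ⟩ | ⟨hev, hJ⟩
    · exact not_exists_sq_sub_mul_sq_of_jacobiSym dvd_rfl hJ
    · exact not_exists_sq_sub_mul_sq_of_jacobiSym (Nat.div_dvd_of_dvd hev.two_dvd) hJ
  refine ⟨hnot, fun S hS hfree => hnot ?_⟩
  have hdZ : (d : ℤ) = (b : ℤ) ^ 2 + (c : ℤ) ^ 2 := by exact_mod_cast hd
  have hsqf : Squarefree (a * (d : ℤ)) :=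
    (squarefree_mul_iff.2 ⟨had.isRelPrime, ha_sqf, Int.squarefree_natCast.2 hd_sqf⟩)
  have hbc := isCoprime_two_mul_of_squarefree hb_odd hd hd_sqf
  have ha0 : a ≠ 0 := ha_sqf.ne_zero
  refine exists_sq_sub_mul_sq_of_isUnit_form hdZ ?_
  rcases he with rfl | ⟨hce, rfl⟩
  · have := isGalois_of_adjoin_sqrt a e c d s z hc.ne' hd hs hz hL
    obtain ⟨F⟩ := exists_cyclicQuarticFrame a e c d s z ha0 hb.ne' hc.ne' hd hd_sqf hs hz hL
    exact F.form_represents_unit hc.ne' hbc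
      (F.exists_component_lattice_of_odd hd hc.ne' hd_sqf ha_odd hsqf hb_odd) S hS hfree
  · have hd' : d = e ^ 2 + b ^ 2 := by rw [hd, add_comm]
    have := isGalois_of_adjoin_sqrt a e b d s z hb.ne' hd' hs hz hL
    obtain ⟨F⟩ := exists_cyclicQuarticFrame a e b d s z ha0 hc.ne' hb.ne' hd' hd_sqf hs hz hL
    -- Here the frame is built with `b` and `c` exchanged; `swap` returns to the same form, with `2
    -- * a` in place of `a`.
    exact (F.swap hd' hb.ne').form_represents_unit hc.ne' hbc
      ((F.swap hd' hb.ne').exists_component_lattice_of_two_mul_odd hd hc.ne' hd_sqf ha_odd hsqf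
        hb_odd hce) S hS hfree
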